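/- **Model.** For each $p\in\mathbb N$ let $n,s_0,r\in\mathbb N$, $\epsilon>0$, $\delta\in(0,1)$ be functions of $p$. Let $X\in\mathbb R^{n\times p}$ have i.i.d. entries from a fixed law $\mathcal D$ supported on $[-b,b]$ with mean $0$ and variance $1$. Let $y=X\theta_0+\xi$, where $\|\theta_0\|_2=1$, $\theta_0\in\mathbb R^p$ has exactly $s_0$ nonzero entries (for all large $p$), and $\xi_1,\dots,\xi_n$ are i.i.d. $N(0,\sigma^2)$ conditioned on $[-b_n,b_n]$, with $\sigma>0$, $\sigma=\Theta(1)$ (e.g. constant), $b_n=O(\sigma\sqrt{\log n})$ and $b_n/\sigma-\sqrt{2\log(2n)}\to\infty$. Let $R=[R_1\,R_2\,R_3]\in\mathbb R^{r\times(n+p+1)}$ have i.i.d. $N(0,1/r)$ entries, with $X,\xi,R$ independent. Put $$B^2=2pb^2+(b\sqrt{s_0}+b_n)^2,\qquad w^2=\frac{4B^2}{\epsilon}\Big(\sqrt{2r\log(4/\delta)}+\log(4/\delta)\Big),$$ $$[X^*\ y^*]=R\begin{bmatrix}X\ \ y\\ wI_{p+1}\end{bmatrix},\qquad \lambda=C_\lambda\,\sigma\max\Big\{\sqrt{\tfrac{\log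 p}{n}},\sqrt{\tfrac{(\log p)^3}{r}}\Big\},\qquad \widehat\theta^*\in\arg\min_{\theta\in\mathbb R^p}\frac1{2n}\|X^*\theta-y^*\|_2^2+\lambda\|\theta\|_1,$$ $$\rho_n^2=\frac{n+r+1}{nr}+\frac{w^2}{nr},\qquad \phi_w=1+\frac{w^2}{n},\qquad \kappa_n=2\lambda\sqrt{s_0}+\frac{w^2}{n},$$ $$\Delta=\Big(\tfrac1nX^\top X-I_p\Big)(\theta_0-\widehat\theta^*)+\tfrac1n[X^\top\ wI_p\ 0](R^\top R-I_{n+p+1})\begin{bmatrix}X(\theta_0-\widehat\theta^*)\\-w\widehat\theta^*\\w\end{bmatrix}$$ ($\Delta$ is the bias of the debiased private Lasso estimator). **Theorem.** There is an absolute constant $C_\lambda>0$ such that the following holds. Let $\alpha>2$, $\gamma>3/4$, $c_0\in(0,1)$, let $n=p^\alpha$ and $s_0=c_0p$ (each up to rounding by at most $1$), $\epsilon=p^\gamma$, and $\log(1/\delta)=O(\log p)$. Then there is a choice of $r=r(p)\to\infty$, not depending on $\mathcal D,b,\sigma,b_n,\theta_0$, such that in every model as above, as $p\to\infty$, the following four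 conditions hold: 1. $\dfrac{\kappa_n^2}{\lambda^2\phi_w}=o\Big(\sqrt{\tfrac n{\log p}}\,\min\big\{1,\sqrt{\tfrac rn},\tfrac{\sqrt{rn}}{w^2}\big\}\Big)$; 2. $\sqrt{s_0}=O\left(\dfrac{\max\{\frac1{\sqrt n},\frac{\log p}{\sqrt r}\}}{\max\{\frac{w\log p}{\sqrt{nr}},\frac{w^2}{n}\sqrt{\frac{\log p}{r}}\}}\right)$; 3. $\dfrac{\sqrt{s_0}}{\sigma\rho_n}=o\Big(\min\big\{\tfrac n{w^2}\sqrt{\tfrac r{\log p}},\tfrac{\sqrt{nr}}{w\log p}\big\}\Big)$; 4. $\dfrac{1}{\sigma\rho_n}\dfrac{4\kappa_n^2}{\lambda\phi_w}=o\Big(\min\big\{\sqrt{\tfrac n{\log p}},\sqrt{\tfrac r{\log p}},\tfrac n{w^2}\sqrt{\tfrac r{\log p}},\tfrac{\sqrt{nr}}{w\log p}\big\}\Big)$; and the debiasing property holds: $\mathbb P\big(\|\Delta\|_\infty/(\sigma\rho_n)>\eta\big)\to0$ for every $\eta>0$ (for every choice of the minimizer $\widehat\theta^*$). -/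

import Mathlib

open Filter Topology Asymptotics MeasureTheory ProbabilityTheory

/-- A parameter tuple `(n, p, s₀, r, ε, δ)`: sample size, number of features, sparsity,
number of rows of the random projection, and the two privacy parameters. -/
structure ParamTuple where
  n : ℕ
  p : ℕ
  s₀ : ℕ
  r : ℕ
  ε : ℝ
  δ : ℝ

/-- The known constants of the linear model at a given dimension: the bound `b` on the entries of
the design, the noise level `σ`, and the truncation level `τ` of the noise. -/
structure ModelConsts where
  b : ℝ
  σ : ℝ
  τ : ℝ

/-- The entries of the design have a centred, normalized law supported on `[-b, b]`. -/
def IsDesignLaw (D : Measure ℝ) (b : ℝ) : Prop :=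
  IsProbabilityMeasure D ∧ (∀ᵐ x ∂D, |x| ≤ b) ∧ ∫ x, x ∂D = 0 ∧ ∫ x, x ^ 2 ∂D = 1

/-- Gaussian `N(0, σ²)` conditioned on `[-τ, τ]`. -/
noncomputable def truncatedGaussian (σ τ : ℝ) : Measure ℝ :=
  ProbabilityTheory.cond (gaussianReal 0 (σ ^ 2).toNNReal) (Set.Icc (-τ) τ)

namespace ParamTuple

variable (t : ParamTuple) (c : ModelConsts)

/-- The bound `B` on the Euclidean norm of the data rows (design, knockoff and response). -/
noncomputable def rowBound : ℝ :=
  Real.sqrt (2 * t.p * c.b ^ 2 + (c.b * Real.sqrt t.s₀ + c.τ) ^ 2)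

/-- The privacy parameter `w` of the Johnson–Lindenstrauss privatization. -/
noncomputable def w : ℝ :=
  Real.sqrt (4 * t.rowBound c ^ 2 / t.ε *
    (Real.sqrt (2 * t.r * Real.log (4 / t.δ)) + Real.log (4 / t.δ)))

/-- The Lasso penalty `λ`, with leading constant `C`. -/
noncomputable def penalty (C : ℝ) : ℝ :=
  C * c.σ * max (Real.sqrt (Real.log t.p / t.n)) (Real.sqrt (Real.log t.p ^ 3 / t.r))

noncomputable def rho : ℝ :=
  Real.sqrt (((t.n : ℝ) + t.r + 1) / (t.n * t.r) + t.w c ^ 2 / (t.n * t.r))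

noncomputable def phi : ℝ := 1 + t.w c ^ 2 / t.n

noncomputable def kappa (C : ℝ) : ℝ :=
  2 * t.penalty c C * Real.sqrt t.s₀ + t.w c ^ 2 / t.n

/-- Index set of the columns of the projection matrix `R = [R₁ R₂ R₃]`. -/
abbrev Cols : Type := Fin t.n ⊕ (Fin t.p ⊕ Unit)

/-- Outcomes `(X, ξ, R)`: design matrix, noise vector, projection matrix. -/
abbrev Sample : Type := (Fin t.n → Fin t.p → ℝ) × (Fin t.n → ℝ) × (Fin t.r → t.Cols → ℝ)

/-- Joint law of `(X, ξ, R)`: all entries are independent, those of `X` have law `D`, those of `ξ`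
are truncated Gaussian, and those of `R` are `N(0, 1/r)`. -/
noncomputable def sampleLaw (D : Measure ℝ) : Measure t.Sample :=
  (Measure.pi fun _ => Measure.pi fun _ => D).prod
    ((Measure.pi fun _ => truncatedGaussian c.σ c.τ).prod
      (Measure.pi fun _ => Measure.pi fun _ => gaussianReal 0 (1 / (t.r : NNReal))))

variable {t}

/-- The design matrix `X`. -/
def Sample.X (ω : t.Sample) : Matrix (Fin t.n) (Fin t.p) ℝ := Matrix.of ω.1

/-- The noise vector `ξ`. -/
def Sample.ξ (ω : t.Sample) : Fin t.n → ℝ := ω.2.1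

/-- The projection matrix `R`. -/
def Sample.R (ω : t.Sample) : Matrix (Fin t.r) t.Cols ℝ := Matrix.of ω.2.2

/-- The response `y = X θ₀ + ξ`. -/
def Sample.y (ω : t.Sample) (θ₀ : Fin t.p → ℝ) : Fin t.n → ℝ :=
  ω.X.mulVec θ₀ + ω.ξ

/-- The privatized data `[X* y*] = R [[X y]; w I]`. -/
noncomputable def Sample.release (ω : t.Sample) (θ₀ : Fin t.p → ℝ) :
    Matrix (Fin t.r) (Fin t.p ⊕ Unit) ℝ :=
  ω.R * Matrix.fromRows (Matrix.fromCols ω.X (Matrix.replicateCol Unit (ω.y θ₀)))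
    (t.w c • (1 : Matrix (Fin t.p ⊕ Unit) (Fin t.p ⊕ Unit) ℝ))

/-- `X*`. -/
noncomputable def Sample.privX (ω : t.Sample) (θ₀ : Fin t.p → ℝ) :
    Matrix (Fin t.r) (Fin t.p) ℝ :=
  (ω.release c θ₀).toCols₁

/-- `y*`. -/
noncomputable def Sample.privy (ω : t.Sample) (θ₀ : Fin t.p → ℝ) : Fin t.r → ℝ :=
  fun i => ω.release c θ₀ i (Sum.inr ())

/-- The private Lasso objective `‖X* θ - y*‖₂² / (2n) + λ ‖θ‖₁`. -/
noncomputable def Sample.lassoObjective (ω : t.Sample) (θ₀ : Fin t.p → ℝ) (C : ℝ)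
    (θ : Fin t.p → ℝ) : ℝ :=
  1 / (2 * t.n) * ∑ i, ((ω.privX c θ₀).mulVec θ i - ω.privy c θ₀ i) ^ 2
    + t.penalty c C * ∑ j, |θ j|

/-- `θ` is a private Lasso estimate. -/
def Sample.IsLasso (ω : t.Sample) (θ₀ : Fin t.p → ℝ) (C : ℝ) (θ : Fin t.p → ℝ) : Prop :=
  ∀ θ', ω.lassoObjective c θ₀ C θ ≤ ω.lassoObjective c θ₀ C θ'

/-- The bias
`Δ = (XᵀX / n - I)(θ₀ - θ) + (1/n) [Xᵀ wI 0] (RᵀR - I) [X(θ₀ - θ); -wθ; w]`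
of the debiased estimator built from the Lasso estimate `θ`. -/
noncomputable def Sample.bias (ω : t.Sample) (θ₀ θ : Fin t.p → ℝ) : Fin t.p → ℝ :=
  ((1 / (t.n : ℝ)) • (ω.X.transpose * ω.X) - 1).mulVec (θ₀ - θ) +
    (1 / (t.n : ℝ)) •
      (Matrix.fromCols ω.X.transpose
          (Matrix.fromCols (t.w c • (1 : Matrix (Fin t.p) (Fin t.p) ℝ))
            (0 : Matrix (Fin t.p) Unit ℝ)) *
        (ω.R.transpose * ω.R - 1)).mulVec
        (Sum.elim (ω.X.mulVec (θ₀ - θ)) (Sum.elim (-(t.w c • θ)) (fun _ => t.w c)))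

end ParamTuple

/-- The four sufficient conditions for debiasing, along a sequence of parameters. -/
def SufficientConditions (C : ℝ) (t : ℕ → ParamTuple) (c : ℕ → ModelConsts) : Prop :=
  ((fun k => (t k).kappa (c k) C ^ 2 / ((t k).penalty (c k) C ^ 2 * (t k).phi (c k))) =o[atTop]
    fun k => Real.sqrt ((t k).n / Real.log (t k).p) *
      min 1 (min (Real.sqrt ((t k).r / (t k).n))
        (Real.sqrt ((t k).r * (t k).n) / (t k).w (c k) ^ 2))) ∧
  ((fun k => Real.sqrt (t k).s₀) =O[atTop]
    fun k => max (1 / Real.sqrt (t k).n) (Real.log (t k).p / Real.sqrt (t k).r) /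
      max ((t k).w (c k) * Real.log (t k).p / Real.sqrt ((t k).n * (t k).r))
        ((t k).w (c k) ^ 2 / (t k).n * Real.sqrt (Real.log (t k).p / (t k).r))) ∧
  ((fun k => 1 / ((c k).σ * (t k).rho (c k)) * Real.sqrt (t k).s₀) =o[atTop]
    fun k => min ((t k).n / (t k).w (c k) ^ 2 * Real.sqrt ((t k).r / Real.log (t k).p))
      (Real.sqrt ((t k).n * (t k).r) / ((t k).w (c k) * Real.log (t k).p))) ∧
  ((fun k => 1 / ((c k).σ * (t k).rho (c k)) *
      (4 * (t k).kappa (c k) C ^ 2 / ((t k).penalty (c k) C * (t k).phi (c k)))) =o[atTop]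
    fun k => min (Real.sqrt ((t k).n / Real.log (t k).p))
      (min (Real.sqrt ((t k).r / Real.log (t k).p))
        (min ((t k).n / (t k).w (c k) ^ 2 * Real.sqrt ((t k).r / Real.log (t k).p))
          (Real.sqrt ((t k).n * (t k).r) / ((t k).w (c k) * Real.log (t k).p)))))

/-- The debiasing property `‖Δ‖_∞ = o_p(σ ρ_n)`: the probability that some private Lasso estimate
has `‖Δ‖_∞ / (σ ρ_n) > η` tends to zero for every `η > 0`. The norm on `Fin p → ℝ` is the
sup norm. -/
def DebiasingProperty (C : ℝ) (t : ℕ → ParamTuple) (c : ℕ → ModelConsts) (D : Measure ℝ)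
    (θ₀ : (k : ℕ) → Fin (t k).p → ℝ) : Prop :=
  ∀ η : ℝ, 0 < η →
    Tendsto (fun k => (t k).sampleLaw (c k) D
      {ω | ∃ θ, ParamTuple.Sample.IsLasso (c k) ω (θ₀ k) C θ ∧
        η < ‖ParamTuple.Sample.bias (c k) ω (θ₀ k) θ‖ / ((c k).σ * (t k).rho (c k))})
      atTop (𝓝 0)

/-! ### Exponential tail bounds for independent sums and Gaussian moments. -/

section Concentration

variable {Ω ι : Type*} [MeasurableSpace Ω] [Fintype ι]

/-! Since `n = p ^ α` with `α > 2`, no sparsity argument is needed. The entries of `XᵀX / n - I` are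
`O(log p / √n)`, and `p` times this tends to zero, so the Gram matrix is well conditioned on all of
`ℝ^p`. The projection size is `r ≈ p ^ β` with `β > α`, so `RᵀR - I` contributes errors of smaller
order `log p / √r`.

The Lasso estimate depends on `R`, so concentration is never applied to it directly. It is applied
to finitely many bilinear forms of `RᵀR` in vectors built from `X`, `ξ`, `θ₀` alone: the columns of
`[X; wI; 0]`, the vector `[0; -θ₀; 1]` and the effective noise `[ξ; -wθ₀; w]`. All these estimates,
at deviation level `L = log p`, make up `Sample.Regular`; a union bound over about `p ^ 2` events of
probability `exp(-const · log² p)` shows that it fails with vanishing probability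
(`sampleLaw_not_regular_le`).

On the regular event everything is deterministic. Optimality of the Lasso and the good conditioning
bound the ℓ¹ error (`l1_le_of_basic_inequality`). The bias is linear in the error, apart from a term
in `[0; -θ₀; 1]`, with uniformly small coefficients, which gives a sup-norm bound (`norm_bias_le`);
`ρ ≥ 1 / √n` normalizes it.

What remains is bookkeeping of powers of `p`. `PolyGrowth` ignores factors `p ^ o(1)`, hence all
logarithms and the constants `b`, `σ`, `τ`. The decisive quantity is `w² / n`, of exponent at most
`ν = 1 - γ + β/2 - α`. Everything needed, including the four conditions, follows from `max α (4 -
2γ) < β < 3α/2 + 2γ - 2`, and such a `β` exists when `α > 2` and `γ > 3/4`. -/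

theorem measureReal_ge_sum_pi_le (μ : Measure Ω) [IsProbabilityMeasure μ] {f : ι → Ω → ℝ}
    (hf : ∀ i, Measurable (f i)) {x K : ℝ} (hx : 0 ≤ x)
    (hint : ∀ i, Integrable (fun ω => Real.exp (x * f i ω)) μ)
    (hK : ∀ i, mgf (f i) μ x ≤ Real.exp K) (t : ℝ) :
    (Measure.pi fun _ : ι => μ).real {ω | t ≤ ∑ i, f i (ω i)} ≤
      Real.exp (Fintype.card ι * K - x * t) := by
  have hind : iIndepFun (fun i (ω : ι → Ω) => f i (ω i)) (Measure.pi fun _ : ι => μ) :=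
    iIndepFun_pi fun i => (hf i).aemeasurable
  have hm : ∀ i, Measurable fun ω : ι → Ω => f i (ω i) := fun i =>
    (hf i).comp (measurable_pi_apply i)
  have hmgf : ∀ i, mgf (fun ω : ι → Ω => f i (ω i)) (Measure.pi fun _ : ι => μ) x =
      mgf (f i) μ x := by
    intro i
    have h := (measurePreserving_eval (fun _ : ι => μ) i).map_eq
    conv_rhs => rw [← h]
    rw [mgf_map (measurePreserving_eval (fun _ : ι => μ) i).measurable.aemeasurable]
    · rfl
    · rw [h]; exact (hint i).aestronglyMeasurable
  have hint' : ∀ i ∈ Finset.univ, Integrable (fun ω : ι → Ω => Real.exp (x * f i (ω i)))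
      (Measure.pi fun _ : ι => μ) := fun i _ =>
    (measurePreserving_eval (fun _ : ι => μ) i).integrable_comp_of_integrable (hint i)
  have h1 := measure_ge_le_exp_mul_mgf (μ := Measure.pi fun _ : ι => μ)
    (X := ∑ i, fun ω : ι → Ω => f i (ω i)) t hx (hind.integrable_exp_mul_sum hm hint')
  rw [hind.mgf_sum hm] at h1
  have h2 : ∏ i, mgf (fun ω : ι → Ω => f i (ω i)) (Measure.pi fun _ : ι => μ) x ≤
      Real.exp (Fintype.card ι * K) := by
    calc _ ≤ ∏ _i : ι, Real.exp K :=
          Finset.prod_le_prod (fun _ _ => mgf_nonneg) fun i _ => (hmgf i).trans_le (hK i)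
      _ = _ := by rw [Finset.prod_const, ← Real.exp_nat_mul, Finset.card_univ]
  simp only [Finset.sum_apply] at h1
  refine h1.trans ((mul_le_mul_of_nonneg_left h2 (Real.exp_pos _).le).trans_eq ?_)
  rw [← Real.exp_add]; congr 1; ring

/-- Hoeffding's inequality: a centred variable in `[-M, M]` is sub-Gaussian with parameter `M ^ 2`.
The two-sided bound comes from applying the one-sided one to `f` and `-f`. -/
theorem measureReal_abs_sum_pi_ge_le (μ : Measure Ω) [IsProbabilityMeasure μ] {f : ι → Ω → ℝ}
    (hf : ∀ i, Measurable (f i)) {M : ℝ} (hM : ∀ i, ∀ᵐ ω ∂μ, |f i ω| ≤ M)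
    (h0 : ∀ i, ∫ ω, f i ω ∂μ = 0) {t : ℝ} (ht : 0 ≤ t) :
    (Measure.pi fun _ : ι => μ).real {ω | t ≤ |∑ i, f i (ω i)|} ≤
      2 * Real.exp (-t ^ 2 / (2 * (Fintype.card ι * M ^ 2))) := by
  have key : ∀ g : ι → Ω → ℝ, (∀ i, Measurable (g i)) → (∀ i, ∀ᵐ ω ∂μ, |g i ω| ≤ M) →
      (∀ i, ∫ ω, g i ω ∂μ = 0) → (Measure.pi fun _ : ι => μ).real {ω | t ≤ ∑ i, g i (ω i)} ≤
      Real.exp (-t ^ 2 / (2 * (Fintype.card ι * M ^ 2))) := by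
    intro g hg hgM hg0
    have hsub : ∀ i, HasSubgaussianMGF (g i) ((‖M - (-M)‖₊ / 2) ^ 2) μ := fun i =>
      hasSubgaussianMGF_of_mem_Icc_of_integral_eq_zero (hg i).aemeasurable
        ((hgM i).mono fun ω h => abs_le.mp h) (hg0 i)
    have hind : iIndepFun (fun i (ω : ι → Ω) => g i (ω i)) (Measure.pi fun _ : ι => μ) :=
      iIndepFun_pi fun i => (hg i).aemeasurable
    have hsub' : ∀ i ∈ Finset.univ, HasSubgaussianMGF (fun ω : ι → Ω => g i (ω i))
        ((‖M - (-M)‖₊ / 2) ^ 2) (Measure.pi fun _ : ι => μ) := by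
      intro i _
      have h := (measurePreserving_eval (fun _ : ι => μ) i).map_eq
      have h3 := hsub i
      rw [← h] at h3
      exact HasSubgaussianMGF.of_map (measurable_pi_apply i).aemeasurable h3
    have h1 := HasSubgaussianMGF.measure_sum_ge_le_of_iIndepFun hind hsub' ht
    refine h1.trans_eq ?_
    congr 3
    simp only [Finset.sum_const, Finset.card_univ, nsmul_eq_mul]
    push_cast
    rw [Real.norm_eq_abs, show M - -M = 2 * M by ring, abs_mul, abs_two,
      mul_div_cancel_left₀ _ two_ne_zero, sq_abs]
  have h1 := key f hf hM h0
  have h2 := key (fun i ω => -f i ω) (fun i => (hf i).neg)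
    (fun i => by simpa only [abs_neg] using hM i) (fun i => by rw [integral_neg, h0, neg_zero])
  have h3 : {ω : ι → Ω | t ≤ |∑ i, f i (ω i)|} ⊆
      {ω | t ≤ ∑ i, f i (ω i)} ∪ {ω | t ≤ ∑ i, -f i (ω i)} := by
    intro ω hω
    simp only [Set.mem_ofPred_eq, Set.mem_union, Finset.sum_neg_distrib] at hω ⊢
    exact le_abs.mp hω
  calc _ ≤ _ := measureReal_mono h3
    _ ≤ _ := measureReal_union_le _ _
    _ ≤ _ := by linarith

/-- Characteristic functions: by independence that of the sum factorizes into Gaussian ones, whose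
exponents add. -/
theorem gaussianReal_pi_map_linear {κ : Type*} [Fintype κ] (u : NNReal) (a : κ → ℝ) :
    (Measure.pi fun _ : κ => gaussianReal 0 u).map (fun x => ∑ c, x c * a c) =
      gaussianReal 0 ((∑ c, a c ^ 2).toNNReal * u) := by
  have hm : Measurable fun x : κ → ℝ => ∑ c, x c * a c := by fun_prop
  have := Measure.isProbabilityMeasure_map (μ := Measure.pi fun _ : κ => gaussianReal 0 u)
    hm.aemeasurable
  refine Measure.ext_of_charFun ?_
  ext t
  rw [charFun_apply_real, integral_map hm.aemeasurable (by fun_prop), charFun_gaussianReal]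
  have h1 : ∀ x : κ → ℝ, Complex.exp (t * ((∑ c, x c * a c : ℝ) : ℂ) * Complex.I) =
      ∏ c, Complex.exp (((t * a c : ℝ) : ℂ) * x c * Complex.I) := by
    intro x
    rw [← Complex.exp_sum]
    congr 1
    push_cast
    rw [Finset.mul_sum, Finset.sum_mul]
    exact Finset.sum_congr rfl fun c _ => by ring
  simp_rw [h1]
  rw [integral_fintype_prod_eq_prod (f := fun c (x : ℝ) => Complex.exp (((t * a c : ℝ) : ℂ) * x *
    Complex.I))]
  simp_rw [← charFun_apply_real, charFun_gaussianReal]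
  rw [← Complex.exp_sum]
  congr 1
  have h2 : (((∑ c, a c ^ 2).toNNReal * u : NNReal) : ℝ) = (∑ c, a c ^ 2) * u := by
    rw [NNReal.coe_mul, Real.coe_toNNReal _ (Finset.sum_nonneg fun _ _ => sq_nonneg _)]
  rw [show ((((∑ c, a c ^ 2).toNNReal * u : NNReal) : ℝ) : ℂ) = (∑ c, (a c : ℂ) ^ 2) * (u : ℝ) by
    rw [h2]; push_cast; rfl]
  simp only [Complex.ofReal_zero, mul_zero, zero_mul, zero_sub, Finset.sum_neg_distrib, neg_inj]
  rw [Finset.sum_mul, Finset.sum_mul, Finset.sum_div]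
  refine Finset.sum_congr rfl fun c _ => ?_
  push_cast; ring

theorem integrable_exp_mul_sq_gaussianReal {x : ℝ} (hx : x < 1 / 2) :
    Integrable (fun y => Real.exp (x * y ^ 2)) (gaussianReal 0 1) := by
  rw [gaussianReal_of_var_ne_zero _ one_ne_zero, gaussianPDF_def]
  rw [integrable_withDensity_iff_integrable_smul' (by fun_prop) (by simp)]
  have h := (integrable_exp_neg_mul_sq (b := 1 / 2 - x) (by linarith)).const_mul
    ((Real.sqrt (2 * Real.pi))⁻¹)
  refine h.congr (Eventually.of_forall fun y => ?_)
  simp only [smul_eq_mul]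
  rw [ENNReal.toReal_ofReal (gaussianPDFReal_nonneg _ _ _), gaussianPDFReal]
  simp only [NNReal.coe_one, mul_one, sub_zero]
  rw [mul_assoc, ← Real.exp_add]; congr 2; ring

theorem integral_exp_mul_sq_gaussianReal {x : ℝ} (hx : x < 1 / 2) :
    ∫ y, Real.exp (x * y ^ 2) ∂(gaussianReal 0 1) = (Real.sqrt (1 - 2 * x))⁻¹ := by
  rw [integral_gaussianReal_eq_integral_smul one_ne_zero]
  have h : ∀ y : ℝ, gaussianPDFReal 0 1 y • Real.exp (x * y ^ 2) =
      (Real.sqrt (2 * Real.pi))⁻¹ * Real.exp (-(1 / 2 - x) * y ^ 2) := by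
    intro y
    simp only [smul_eq_mul, gaussianPDFReal, NNReal.coe_one, mul_one, sub_zero]
    rw [mul_assoc, ← Real.exp_add]; congr 2; ring
  simp_rw [h]
  rw [integral_const_mul, integral_gaussian, ← Real.sqrt_inv, ← Real.sqrt_inv,
    ← Real.sqrt_mul (by positivity)]
  congr 1
  have : 1 - 2 * x ≠ 0 := by linarith
  have : 1 / 2 - x ≠ 0 := by intro h; apply this; linarith
  field_simp

/-- The integral is `exp(-x) (1 - 2x)^(-1/2)`. With `u = 2x` and `|u| ≤ 1/2`, the estimate `|log(1 -
u) + u| ≤ u² / (1 - |u|) ≤ 2u²` bounds its logarithm by `u² = 4x²`. -/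
theorem integral_exp_mul_sq_sub_one_gaussianReal_le {x : ℝ} (hx : |x| ≤ 1 / 4) :
    ∫ y, Real.exp (x * (y ^ 2 - 1)) ∂(gaussianReal 0 1) ≤ Real.exp (4 * x ^ 2) := by
  have hx' := abs_le.mp hx
  have h : ∀ y : ℝ, Real.exp (x * (y ^ 2 - 1)) = Real.exp (-x) * Real.exp (x * y ^ 2) := by
    intro y; rw [← Real.exp_add]; congr 1; ring
  simp_rw [h]
  have hpos : 0 < 1 - 2 * x := by linarith [hx'.2]
  rw [integral_const_mul, integral_exp_mul_sq_gaussianReal (by linarith [hx'.2]),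
    Real.sqrt_eq_rpow, Real.rpow_def_of_pos hpos, ← Real.exp_neg, ← Real.exp_add]
  refine Real.exp_le_exp.mpr ?_
  have h2 : |2 * x| ≤ 1 / 2 := by rw [abs_mul, abs_two]; linarith
  have h1 := Real.abs_log_sub_add_sum_range_le (x := 2 * x) (by linarith) 1
  simp only [Finset.range_one, Finset.sum_singleton, Nat.cast_zero, zero_add, pow_one, div_one,
    one_add_one_eq_two, sq_abs] at h1
  have h3 : (2 * x) ^ 2 / (1 - |2 * x|) ≤ 2 * (2 * x) ^ 2 := by
    rw [div_le_iff₀ (by linarith)]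
    nlinarith [sq_nonneg (2 * x)]
  have h4 := (abs_le.mp (h1.trans h3)).1
  linarith

end Concentration

/-! ### Johnson–Lindenstrauss estimates for the Gaussian projection. -/

section GaussianMatrix

variable {ι κ : Type*} [Fintype ι] [Fintype κ]

theorem gaussianReal_pi_map_normalized [Nonempty ι] {a : κ → ℝ} (ha : ∑ c, a c ^ 2 = 1) :
    (Measure.pi fun _ : κ => gaussianReal 0 (1 / (Fintype.card ι : NNReal))).map
      (fun x => Real.sqrt (Fintype.card ι) * ∑ c, x c * a c) = gaussianReal 0 1 := by
  have hm : Measurable fun x : κ → ℝ => ∑ c, x c * a c := by fun_prop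
  have h : (fun x : κ → ℝ => Real.sqrt (Fintype.card ι) * ∑ c, x c * a c) =
      (fun y => Real.sqrt (Fintype.card ι) * y) ∘ fun x => ∑ c, x c * a c := rfl
  rw [h, ← Measure.map_map (by fun_prop) hm, gaussianReal_pi_map_linear, ha,
    gaussianReal_map_const_mul, mul_zero]
  congr 1
  ext
  simp

/-- For a unit vector, the rescaled row products are independent standard normals, so this is a
Chernoff bound for a centred chi-square variable. -/
theorem gaussian_matrix_norm_sq_deviation [Nonempty ι] {a : κ → ℝ} (ha : ∑ c, a c ^ 2 = 1)
    {t : ℝ} (ht0 : 0 ≤ t) (ht : t ≤ 1) :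
    (Measure.pi fun _ : ι => Measure.pi fun _ : κ =>
      gaussianReal 0 (1 / (Fintype.card ι : NNReal))).real
        {R | t ≤ |∑ i, (∑ c, R i c * a c) ^ 2 - 1|} ≤
      2 * Real.exp (-(Fintype.card ι * t ^ 2) / 16) := by
  obtain ⟨m, hm⟩ : ∃ m : ℝ, m = (Fintype.card ι : ℝ) := ⟨_, rfl⟩
  rw [← hm]
  have hm0 : 0 < m := by rw [hm]; exact_mod_cast Fintype.card_pos
  set μ := Measure.pi fun _ : κ => gaussianReal 0 (1 / (Fintype.card ι : NNReal)) with hμ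
  have hmap := gaussianReal_pi_map_normalized (ι := ι) ha
  rw [← hm] at hmap
  have hmeas : Measurable fun x : κ → ℝ => Real.sqrt m * ∑ c, x c * a c := by fun_prop
  have key : ∀ s : ℝ, |s| = 1 → (Measure.pi fun _ : ι => μ).real
      {R | m * t ≤ ∑ i, s * ((Real.sqrt m * ∑ c, R i c * a c) ^ 2 - 1)} ≤
      Real.exp (-(m * t ^ 2) / 16) := by
    intro s hs
    have hxs : |t / 8 * s| ≤ 1 / 4 := by
      rw [abs_mul, hs, mul_one, abs_of_nonneg (by linarith)]; linarith
    have hrew : ∀ y : ℝ, t / 8 * (s * (y ^ 2 - 1)) = (t / 8 * s) * (y ^ 2 - 1) := fun y => by ring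
    have hint1 : Integrable (fun y : ℝ => Real.exp (t / 8 * (s * (y ^ 2 - 1))))
        (gaussianReal 0 1) := by
      have := (integrable_exp_mul_sq_gaussianReal (x := t / 8 * s)
        (by linarith [(abs_le.mp hxs).2])).const_mul (Real.exp (-(t / 8 * s)))
      refine this.congr (Eventually.of_forall fun y => ?_)
      simp only
      rw [← Real.exp_add]; congr 1; ring
    have hf : Measurable fun x : κ → ℝ => s * ((Real.sqrt m * ∑ c, x c * a c) ^ 2 - 1) := by
      fun_prop
    -- The parameter `t / 8` minimizes `4x² - x t`, with value `-t² / 16`; it stays below the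
    -- threshold `1/4` because `t ≤ 1`.
    have h := measureReal_ge_sum_pi_le (ι := ι) μ
      (f := fun _ x => s * ((Real.sqrt m * ∑ c, x c * a c) ^ 2 - 1)) (fun _ => hf)
      (x := t / 8) (K := 4 * (t / 8) ^ 2) (by linarith) ?_ ?_ (m * t)
    · refine h.trans_eq ?_
      rw [← hm]; congr 1; ring
    · intro _
      rw [← hmap] at hint1
      exact (integrable_map_measure (by fun_prop) hmeas.aemeasurable).mp hint1
    · intro _
      have h1 := integral_exp_mul_sq_sub_one_gaussianReal_le hxs
      rw [← hmap, integral_map hmeas.aemeasurable (by fun_prop)] at h1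
      rw [mgf]
      simp_rw [hrew]
      refine h1.trans_eq ?_
      congr 1
      rw [mul_pow, ← sq_abs s, hs]; ring
  have hsum : ∀ R : ι → κ → ℝ, ∑ i, ((Real.sqrt m * ∑ c, R i c * a c) ^ 2 - 1) =
      m * (∑ i, (∑ c, R i c * a c) ^ 2 - 1) := by
    intro R
    rw [Finset.sum_sub_distrib]
    simp only [mul_pow, Real.sq_sqrt hm0.le, ← Finset.mul_sum]
    simp [hm]; ring
  have h1 := key 1 (by simp)
  have h2 := key (-1) (by simp)
  simp only [← Finset.mul_sum, hsum] at h1 h2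
  have h3 : {R : ι → κ → ℝ | t ≤ |∑ i, (∑ c, R i c * a c) ^ 2 - 1|} ⊆
      {R | m * t ≤ 1 * (m * (∑ i, (∑ c, R i c * a c) ^ 2 - 1))} ∪
      {R | m * t ≤ -1 * (m * (∑ i, (∑ c, R i c * a c) ^ 2 - 1))} := by
    intro R hR
    simp only [Set.mem_ofPred_eq, Set.mem_union] at hR ⊢
    rcases le_abs.mp hR with h | h
    · left; rw [one_mul]; exact mul_le_mul_of_nonneg_left h hm0.le
    · right
      rw [show -1 * (m * (∑ i, (∑ c, R i c * a c) ^ 2 - 1)) =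
        m * -(∑ i, (∑ c, R i c * a c) ^ 2 - 1) by ring]
      exact mul_le_mul_of_nonneg_left h hm0.le
  calc _ ≤ _ := measureReal_mono h3
    _ ≤ _ := measureReal_union_le _ _
    _ ≤ _ := by linarith

/-- Gaussian random projections preserve inner products. -/
theorem gaussian_matrix_inner_deviation [Nonempty ι] (a c : κ → ℝ)
    {t : ℝ} (ht0 : 0 < t) (ht : t ≤ 1) :
    (Measure.pi fun _ : ι => Measure.pi fun _ : κ =>
      gaussianReal 0 (1 / (Fintype.card ι : NNReal))).real
        {R | t * (Real.sqrt (∑ k, a k ^ 2) * Real.sqrt (∑ k, c k ^ 2)) <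
          |∑ i, (∑ k, R i k * a k) * (∑ k, R i k * c k) - ∑ k, a k * c k|} ≤
      4 * Real.exp (-(Fintype.card ι * t ^ 2) / 16) := by
  set P := (Measure.pi fun _ : ι => Measure.pi fun _ : κ =>
      gaussianReal 0 (1 / (Fintype.card ι : NNReal))) with hP
  -- deviation of the squared norm, for an arbitrary vector
  have hdev : ∀ v : κ → ℝ, P.real {R | t * (∑ k, v k ^ 2) <
      |∑ i, (∑ k, R i k * v k) ^ 2 - ∑ k, v k ^ 2|} ≤
      2 * Real.exp (-(Fintype.card ι * t ^ 2) / 16) := by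
    intro v
    set q := ∑ k, v k ^ 2 with hq
    have hq0 : 0 ≤ q := Finset.sum_nonneg fun _ _ => sq_nonneg _
    rcases hq0.eq_or_lt with h | h
    · have hv : ∀ k, v k = 0 := by
        intro k
        have := (Finset.sum_eq_zero_iff_of_nonneg (fun k _ => sq_nonneg (v k))).mp h.symm k
          (Finset.mem_univ k)
        exact pow_eq_zero_iff (two_ne_zero) |>.mp this
      have : {R : ι → κ → ℝ | t * q < |∑ i, (∑ k, R i k * v k) ^ 2 - q|} = ∅ := by
        ext R; simp [hv, ← h]
      rw [this, measureReal_empty]; positivity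
    · have hs : 0 < Real.sqrt q := Real.sqrt_pos.mpr h
      have h1 : ∑ k, (v k / Real.sqrt q) ^ 2 = 1 := by
        simp only [div_pow, Real.sq_sqrt hq0, ← Finset.sum_div]
        exact div_self h.ne'
      refine (measureReal_mono ?_).trans (gaussian_matrix_norm_sq_deviation (ι := ι) h1 ht0.le ht)
      intro R hR
      simp only [Set.mem_ofPred_eq] at hR ⊢
      have h2 : ∑ i, (∑ k, R i k * (v k / Real.sqrt q)) ^ 2 - 1 =
          (∑ i, (∑ k, R i k * v k) ^ 2 - q) / q := by
        simp only [← mul_div_assoc, ← Finset.sum_div, div_pow, Real.sq_sqrt hq0]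
        field_simp
      rw [h2, abs_div, abs_of_pos h, le_div_iff₀ h]
      exact hR.le
  set x := Real.sqrt (∑ k, a k ^ 2) with hx
  set y := Real.sqrt (∑ k, c k ^ 2) with hy
  have hxsq : x ^ 2 = ∑ k, a k ^ 2 := Real.sq_sqrt (Finset.sum_nonneg fun _ _ => sq_nonneg _)
  have hysq : y ^ 2 = ∑ k, c k ^ 2 := Real.sq_sqrt (Finset.sum_nonneg fun _ _ => sq_nonneg _)
  have hx0 : 0 ≤ x := Real.sqrt_nonneg _
  have hy0 : 0 ≤ y := Real.sqrt_nonneg _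
  have hzero : ∀ v : κ → ℝ, Real.sqrt (∑ k, v k ^ 2) = 0 → ∀ k, v k = 0 := by
    intro v h k
    rw [Real.sqrt_eq_zero (Finset.sum_nonneg fun _ _ => sq_nonneg _)] at h
    have := (Finset.sum_eq_zero_iff_of_nonneg (fun k _ => sq_nonneg (v k))).mp h k
      (Finset.mem_univ k)
    exact pow_eq_zero_iff (two_ne_zero) |>.mp this
  rcases hx0.eq_or_lt with h | hx0
  · have hv := hzero a h.symm
    have : {R : ι → κ → ℝ | t * (x * y) <
        |∑ i, (∑ k, R i k * a k) * (∑ k, R i k * c k) - ∑ k, a k * c k|} = ∅ := by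
      ext R; simp [hv, ← h]
    rw [this, measureReal_empty]; positivity
  rcases hy0.eq_or_lt with h | hy0
  · have hv := hzero c h.symm
    have : {R : ι → κ → ℝ | t * (x * y) <
        |∑ i, (∑ k, R i k * a k) * (∑ k, R i k * c k) - ∑ k, a k * c k|} = ∅ := by
      ext R; simp [hv, ← h]
    rw [this, measureReal_empty]; positivity
  -- Polarization with the vectors `y a ± x c`. The weights give both summands the norm `x y`, so
  -- the two squared norms add up to `4 x² y²`, while the difference of the two deviations is `4 x
  -- y` times the deviation of the inner product.
  have hlin : ∀ (s : ℝ) (R : κ → ℝ), ∑ k, R k * (y * a k + s * x * c k) =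
      y * ∑ k, R k * a k + s * x * ∑ k, R k * c k := by
    intro s R
    rw [Finset.mul_sum, Finset.mul_sum, ← Finset.sum_add_distrib]
    exact Finset.sum_congr rfl fun k _ => by ring
  have hnorm : ∀ s : ℝ, ∑ k, (y * a k + s * x * c k) ^ 2 =
      y ^ 2 * x ^ 2 + 2 * s * x * y * (∑ k, a k * c k) + s ^ 2 * x ^ 2 * y ^ 2 := by
    intro s
    rw [hysq, hxsq, ← hysq, ← hxsq]
    conv_rhs => rw [hxsq]
    rw [show s ^ 2 * (∑ k, a k ^ 2) * y ^ 2 = s ^ 2 * x ^ 2 * y ^ 2 by rw [hxsq]]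
    rw [show s ^ 2 * x ^ 2 * y ^ 2 = s ^ 2 * x ^ 2 * ∑ k, c k ^ 2 by rw [hysq]]
    rw [Finset.mul_sum, Finset.mul_sum, Finset.mul_sum, ← Finset.sum_add_distrib,
      ← Finset.sum_add_distrib]
    exact Finset.sum_congr rfl fun k _ => by ring
  have h1 := hdev fun k => y * a k + 1 * x * c k
  have h2 := hdev fun k => y * a k + (-1) * x * c k
  refine (measureReal_mono ?_).trans ((measureReal_union_le _ _).trans (by linarith :
    P.real {R | t * (∑ k, (y * a k + 1 * x * c k) ^ 2) <
      |∑ i, (∑ k, R i k * (y * a k + 1 * x * c k)) ^ 2 - ∑ k, (y * a k + 1 * x * c k) ^ 2|} +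
    P.real {R | t * (∑ k, (y * a k + (-1) * x * c k) ^ 2) <
      |∑ i, (∑ k, R i k * (y * a k + (-1) * x * c k)) ^ 2 -
        ∑ k, (y * a k + (-1) * x * c k) ^ 2|} ≤ _))
  intro R hR
  simp only [Set.mem_ofPred_eq, Set.mem_union] at hR ⊢
  by_contra! hcon
  obtain ⟨hc1, hc2⟩ := hcon
  have hexp : ∀ s : ℝ, ∑ i, (∑ k, R i k * (y * a k + s * x * c k)) ^ 2 =
      y ^ 2 * (∑ i, (∑ k, R i k * a k) ^ 2) +
      2 * s * x * y * (∑ i, (∑ k, R i k * a k) * (∑ k, R i k * c k)) +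
      s ^ 2 * x ^ 2 * ∑ i, (∑ k, R i k * c k) ^ 2 := by
    intro s
    simp only [hlin]
    rw [Finset.mul_sum, Finset.mul_sum, Finset.mul_sum, ← Finset.sum_add_distrib,
      ← Finset.sum_add_distrib]
    exact Finset.sum_congr rfl fun k _ => by ring
  rw [hexp, hnorm] at hc1 hc2
  rw [abs_le] at hc1 hc2
  set S := ∑ i, (∑ k, R i k * a k) * (∑ k, R i k * c k)
  set T := ∑ k, a k * c k
  have hxy : 0 < x * y := mul_pos hx0 hy0
  have h4 : 4 * (x * y) * |S - T| ≤ 4 * (x * y) * (t * (x * y)) := by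
    rw [← abs_of_pos (by positivity : 0 < 4 * (x * y)), ← abs_mul,
      abs_of_pos (by positivity : 0 < 4 * (x * y)), abs_le]
    constructor <;> nlinarith [hc1.1, hc1.2, hc2.1, hc2.2]
  have := le_of_mul_le_mul_left h4 (by positivity)
  linarith

end GaussianMatrix

/-! ### Concentration of the design. -/

section DesignLaw

variable {D : Measure ℝ} {b : ℝ}

theorem IsDesignLaw.one_le_sq (h : IsDesignLaw D b) : 1 ≤ b ^ 2 := by
  obtain ⟨hP, hb, -, h2⟩ := h
  have h3 : ∫ x, x ^ 2 ∂D ≤ ∫ _, b ^ 2 ∂D := by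
    refine integral_mono_of_nonneg (Eventually.of_forall fun x => sq_nonneg x)
      (integrable_const _) (hb.mono fun x hx => ?_)
    exact sq_le_sq.mpr (hx.trans (le_abs_self b))
  rw [h2] at h3
  simpa using h3

theorem IsDesignLaw.pos (h : IsDesignLaw D b) : 0 < b := by
  have h1 := h.one_le_sq
  obtain ⟨hP, hb, -, -⟩ := h
  obtain ⟨x, hx⟩ := hb.exists
  rcases ((abs_nonneg x).trans hx).eq_or_lt with h | h
  · rw [← h] at h1; norm_num at h1
  · exact h

theorem IsDesignLaw.ae_pi_le {κ : Type*} [Fintype κ] (h : IsDesignLaw D b) :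
    ∀ᵐ x ∂(Measure.pi fun _ : κ => D), ∀ j, |x j| ≤ b := by
  have := h.1
  exact eventually_all.2 fun j => (Measure.tendsto_eval_ae_ae (μ := fun _ : κ => D)).eventually h.2.1

theorem IsDesignLaw.ae_pi_pi_le {ι κ : Type*} [Fintype ι] [Fintype κ] (h : IsDesignLaw D b) :
    ∀ᵐ x ∂(Measure.pi fun _ : ι => Measure.pi fun _ : κ => D), ∀ i j, |x i j| ≤ b := by
  have := h.1
  exact eventually_all.2 fun i => (Measure.tendsto_eval_ae_ae
    (μ := fun _ : ι => Measure.pi fun _ : κ => D)).eventually h.ae_pi_le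

theorem IsDesignLaw.integral_eval {κ : Type*} [Fintype κ] (h : IsDesignLaw D b) (j : κ) :
    ∫ x, x j ∂(Measure.pi fun _ : κ => D) = 0 := by
  have := h.1
  have h1 := (measurePreserving_eval (fun _ : κ => D) j).map_eq
  rw [← h.2.2.1]
  conv_rhs => rw [← h1]
  rw [integral_map (measurePreserving_eval (fun _ : κ => D) j).measurable.aemeasurable
    (by fun_prop)]

theorem IsDesignLaw.integral_mul {κ : Type*} [Fintype κ] [DecidableEq κ] (h : IsDesignLaw D b)
    (j k : κ) :
    ∫ x, (x j * x k - if j = k then 1 else 0) ∂(Measure.pi fun _ : κ => D) = 0 := by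
  have := h.1
  have hint : Integrable (fun x : κ → ℝ => x j * x k) (Measure.pi fun _ : κ => D) := by
    refine Integrable.of_bound (by fun_prop) (b * b) (h.ae_pi_le.mono fun x hx => ?_)
    rw [Real.norm_eq_abs, abs_mul]
    exact mul_le_mul (hx j) (hx k) (abs_nonneg _) h.pos.le
  rw [integral_sub hint (integrable_const _), integral_const, probReal_univ, one_smul]
  split_ifs with hjk
  · subst hjk
    have h1 := (measurePreserving_eval (fun _ : κ => D) j).map_eq
    have h2 := h.2.2.2
    rw [← h1, integral_map (measurePreserving_eval (fun _ : κ => D) j).measurable.aemeasurable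
      (by fun_prop)] at h2
    simp only [Function.eval] at h2
    simp_rw [← sq]
    rw [h2, sub_self]
  · have hind : iIndepFun (fun i (x : κ → ℝ) => x i) (Measure.pi fun _ : κ => D) :=
      iIndepFun_pi (X := fun _ => id) fun _ => aemeasurable_id
    have h2 := (hind.indepFun hjk).integral_fun_mul_eq_mul_integral
      (measurable_pi_apply j).aestronglyMeasurable (measurable_pi_apply k).aestronglyMeasurable
    rw [h2, h.integral_eval, zero_mul, sub_zero]

/-- Hoeffding's inequality over the rows; the bound `b ^ 2 + 1` on a summand includes the centring
by the identity matrix. -/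
theorem IsDesignLaw.gram_deviation {ι κ : Type*} [Fintype ι] [Fintype κ] [DecidableEq κ]
    (h : IsDesignLaw D b) [Nonempty ι] (j k : κ) {L : ℝ} (hL : 0 ≤ L) :
    (Measure.pi fun _ : ι => Measure.pi fun _ : κ => D).real
      {x | Real.sqrt (Fintype.card ι) * L < |∑ i, (x i j * x i k - if j = k then 1 else 0)|} ≤
      2 * Real.exp (-L ^ 2 / (2 * (b ^ 2 + 1) ^ 2)) := by
  have := h.1
  have h1 := measureReal_abs_sum_pi_ge_le (ι := ι) (Measure.pi fun _ : κ => D)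
    (f := fun _ x => x j * x k - if j = k then 1 else 0) (fun _ => by fun_prop)
    (M := b ^ 2 + 1) (fun _ => h.ae_pi_le.mono fun x hx => ?_) (fun _ => h.integral_mul j k)
    (t := Real.sqrt (Fintype.card ι) * L) (by positivity)
  · refine (measureReal_mono fun x hx => ?_).trans (h1.trans_eq ?_)
    · exact (Set.mem_ofPred_eq.mp hx).le
    · have hc : (Fintype.card ι : ℝ) ≠ 0 := by exact_mod_cast Fintype.card_ne_zero
      have hb : b ^ 2 + 1 ≠ 0 := by positivity
      congr 2
      rw [mul_pow, Real.sq_sqrt (Nat.cast_nonneg _)]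
      field_simp
  · refine (abs_sub _ _).trans (add_le_add ?_ ?_)
    · rw [abs_mul, sq]
      exact mul_le_mul (hx j) (hx k) (abs_nonneg _) h.pos.le
    · split_ifs <;> simp

/-- The noise is frozen: given `ξ`, the randomness and centring of `X` already make the correlation
small, so only the truncation level `τ` matters. -/
theorem IsDesignLaw.noise_deviation {ι κ : Type*} [Fintype ι] [Fintype κ]
    (h : IsDesignLaw D b) [Nonempty ι] {τ : ℝ} (hτ : 0 < τ) {ξ : ι → ℝ} (hξ : ∀ i, |ξ i| ≤ τ)
    (j : κ) {L : ℝ} (hL : 0 ≤ L) :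
    (Measure.pi fun _ : ι => Measure.pi fun _ : κ => D).real
      {x | Real.sqrt (Fintype.card ι) * L * τ < |∑ i, x i j * ξ i|} ≤
      2 * Real.exp (-L ^ 2 / (2 * b ^ 2)) := by
  have := h.1
  have h1 := measureReal_abs_sum_pi_ge_le (ι := ι) (Measure.pi fun _ : κ => D)
    (f := fun i x => x j * ξ i) (fun _ => by fun_prop)
    (M := b * τ) (fun i => h.ae_pi_le.mono fun x hx => ?_)
    (fun i => by rw [integral_mul_const, h.integral_eval, zero_mul])
    (t := Real.sqrt (Fintype.card ι) * L * τ) (by positivity)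
  · refine (measureReal_mono fun x hx => ?_).trans (h1.trans_eq ?_)
    · exact (Set.mem_ofPred_eq.mp hx).le
    · have hc : (Fintype.card ι : ℝ) ≠ 0 := by exact_mod_cast Fintype.card_ne_zero
      have hb := h.pos.ne'
      congr 2
      rw [mul_pow, mul_pow, Real.sq_sqrt (Nat.cast_nonneg _)]
      field_simp
  · rw [abs_mul]
    exact mul_le_mul (hx j) (hξ i) (abs_nonneg _) h.pos.le

end DesignLaw

theorem isProbabilityMeasure_truncatedGaussian {σ τ : ℝ} (hσ : 0 < σ) (hτ : 0 < τ) :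
    IsProbabilityMeasure (truncatedGaussian σ τ) := by
  refine cond_isProbabilityMeasure ?_
  have hv : (σ ^ 2).toNNReal ≠ 0 := by
    rw [Ne, Real.toNNReal_eq_zero, not_le]; positivity
  intro h
  have h1 : volume (Set.Icc (-τ) τ) = 0 := gaussianReal_absolutelyContinuous' 0 hv h
  rw [Real.volume_Icc, ENNReal.ofReal_eq_zero] at h1
  linarith

theorem ae_truncatedGaussian_abs_le (σ τ : ℝ) : ∀ᵐ x ∂(truncatedGaussian σ τ), |x| ≤ τ :=
  (ae_cond_mem measurableSet_Icc).mono fun _ hx => abs_le.mpr hx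

/-! ### Conditioning on all but one factor of a triple product. -/

section Slices

variable {α β γ : Type*} [MeasurableSpace α] [MeasurableSpace β] [MeasurableSpace γ]
  {μ : Measure α} {ν : Measure β} {ρ : Measure γ}

/-- The slice bound is required only for almost every `y`, because the truncation bound on the noise
holds almost surely. -/
theorem prod_prod_measure_le_of_slice₁ [IsProbabilityMeasure μ] [IsProbabilityMeasure ν]
    [IsProbabilityMeasure ρ] {S : Set (α × β × γ)} (hS : MeasurableSet S) {q : ℝ}
    (h : ∀ᵐ y ∂ν, ∀ z, μ.real {x | (x, y, z) ∈ S} ≤ q) :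
    (μ.prod (ν.prod ρ)) S ≤ ENNReal.ofReal q := by
  rw [Measure.prod_apply_symm hS]
  have h' : ∀ᵐ w ∂(ν.prod ρ), μ ((fun x => (x, w)) ⁻¹' S) ≤ ENNReal.ofReal q := by
    refine (Measure.quasiMeasurePreserving_fst.ae h).mono fun w hw => ?_
    rw [← ofReal_measureReal]
    exact ENNReal.ofReal_le_ofReal (hw w.2)
  refine (lintegral_mono_ae h').trans_eq ?_
  simp

theorem prod_prod_measure_le_of_slice₃ [IsProbabilityMeasure μ] [IsProbabilityMeasure ν]
    [IsProbabilityMeasure ρ] {S : Set (α × β × γ)} (hS : MeasurableSet S) {q : ℝ}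
    (h : ∀ x y, ρ.real {z | (x, y, z) ∈ S} ≤ q) :
    (μ.prod (ν.prod ρ)) S ≤ ENNReal.ofReal q := by
  rw [Measure.prod_apply hS]
  have h' : ∀ x, (ν.prod ρ) (Prod.mk x ⁻¹' S) ≤ ENNReal.ofReal q := by
    intro x
    rw [Measure.prod_apply (measurable_prodMk_left hS)]
    have h'' : ∀ y, ρ (Prod.mk y ⁻¹' (Prod.mk x ⁻¹' S)) ≤ ENNReal.ofReal q := by
      intro y
      rw [← ofReal_measureReal]
      exact ENNReal.ofReal_le_ofReal (h x y)
    refine (lintegral_mono h'').trans_eq ?_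
    simp
  refine (lintegral_mono h').trans_eq ?_
  simp

end Slices

/-! ### The regular event and its probability. -/

namespace ParamTuple

variable {t : ParamTuple} (c : ModelConsts)

/-- The `j`-th column of the privatization matrix `[X; w I; 0]`. -/
noncomputable def Sample.col (ω : t.Sample) (j : Fin t.p) : t.Cols → ℝ :=
  Sum.elim (fun i => ω.1 i j) (Sum.elim (fun k => if k = j then t.w c else 0) fun _ => 0)

/-- The vector `[0; -θ₀; 1]`. -/
def shift (θ₀ : Fin t.p → ℝ) : t.Cols → ℝ :=
  Sum.elim (fun _ => 0) (Sum.elim (fun k => -θ₀ k) fun _ => 1)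

/-- The privatized noise vector `[ξ; -w θ₀; w]`. -/
noncomputable def Sample.noise (ω : t.Sample) (θ₀ : Fin t.p → ℝ) : t.Cols → ℝ :=
  Sum.elim ω.2.1 (Sum.elim (fun k => -(t.w c * θ₀ k)) fun _ => t.w c)

/-- Squared Euclidean norm. -/
def normSq (u : t.Cols → ℝ) : ℝ := ∑ k, u k ^ 2

/-- The bilinear form of `RᵀR`. -/
def Sample.form (ω : t.Sample) (u v : t.Cols → ℝ) : ℝ :=
  ∑ i, (∑ k, ω.2.2 i k * u k) * (∑ k, ω.2.2 i k * v k)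

/-- The event that the sample behaves regularly, at deviation level `L`. -/
structure Sample.Regular (θ₀ : Fin t.p → ℝ) (L : ℝ) (ω : t.Sample) : Prop where
  abs_design_le : ∀ i j, |ω.1 i j| ≤ c.b
  abs_noise_le : ∀ i, |ω.2.1 i| ≤ c.τ
  gram : ∀ j k, |∑ i, (ω.1 i j * ω.1 i k - if j = k then 1 else 0)| ≤ Real.sqrt t.n * L
  corr : ∀ j, |∑ i, ω.1 i j * ω.2.1 i| ≤ Real.sqrt t.n * L * c.τ
  form_col : ∀ j k, |ω.form (ω.col c j) (ω.col c k) - ∑ l, ω.col c j l * ω.col c k l| ≤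
    L / Real.sqrt t.r * (Real.sqrt (normSq (ω.col c j)) * Real.sqrt (normSq (ω.col c k)))
  form_shift : ∀ j, |ω.form (ω.col c j) (shift θ₀) - ∑ l, ω.col c j l * shift θ₀ l| ≤
    L / Real.sqrt t.r * (Real.sqrt (normSq (ω.col c j)) * Real.sqrt (normSq (shift θ₀)))
  form_noise : ∀ j, |ω.form (ω.col c j) (ω.noise c θ₀) - ∑ l, ω.col c j l * ω.noise c θ₀ l| ≤
    L / Real.sqrt t.r * (Real.sqrt (normSq (ω.col c j)) * Real.sqrt (normSq (ω.noise c θ₀)))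

theorem measurable_col (j : Fin t.p) (l : t.Cols) :
    Measurable fun ω : t.Sample => ω.col c j l := by
  rcases l with i | k | u
  · simp only [Sample.col, Sum.elim_inl]; fun_prop
  · simp only [Sample.col, Sum.elim_inl, Sum.elim_inr]; fun_prop
  · simp only [Sample.col, Sum.elim_inr]; fun_prop

theorem measurable_noise (θ₀ : Fin t.p → ℝ) (l : t.Cols) :
    Measurable fun ω : t.Sample => ω.noise c θ₀ l := by
  rcases l with i | k | u
  · simp only [Sample.noise, Sum.elim_inl]; fun_prop
  · simp only [Sample.noise, Sum.elim_inl, Sum.elim_inr]; fun_prop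
  · simp only [Sample.noise, Sum.elim_inr]; fun_prop

/-- For vectors that depend on the data but not on the projection, the form `RᵀR` concentrates. -/
theorem sampleLaw_form_deviation {D : Measure ℝ} (hD : IsDesignLaw D c.b) (hσ : 0 < c.σ)
    (hτ : 0 < c.τ) (hr : 0 < t.r) {L : ℝ} (hL : 0 < L) (hLr : L ≤ Real.sqrt t.r)
    (u v : t.Sample → t.Cols → ℝ) (hu : ∀ l, Measurable fun ω => u ω l)
    (hv : ∀ l, Measurable fun ω => v ω l)
    (hu' : ∀ x y z z', u (x, y, z) = u (x, y, z')) (hv' : ∀ x y z z', v (x, y, z) = v (x, y, z')) :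
    t.sampleLaw c D {ω | L / Real.sqrt t.r * (Real.sqrt (normSq (u ω)) * Real.sqrt (normSq (v ω))) <
      |ω.form (u ω) (v ω) - ∑ l, u ω l * v ω l|} ≤
    ENNReal.ofReal (4 * Real.exp (-L ^ 2 / 16)) := by
  have := hD.1
  have := isProbabilityMeasure_truncatedGaussian hσ hτ
  have : Nonempty (Fin t.r) := ⟨⟨0, hr⟩⟩
  have hr' : (0 : ℝ) < t.r := by exact_mod_cast hr
  refine prod_prod_measure_le_of_slice₃ ?_ fun x y => ?_
  · have h2 : ∀ i k, Measurable fun ω : t.Sample => ω.2.2 i k := fun i k => by fun_prop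
    refine measurableSet_lt ?_ ?_
    · unfold normSq; fun_prop
    · unfold Sample.form; fun_prop
  -- With `X` and `ξ` fixed, `u` and `v` are constant vectors; they may be evaluated at the
  -- projection `0`.
  · have h := gaussian_matrix_inner_deviation (ι := Fin t.r) (u (x, y, 0)) (v (x, y, 0))
      (t := L / Real.sqrt t.r) (by positivity) ((div_le_one (by positivity)).mpr hLr)
    rw [Fintype.card_fin] at h
    have he : -(t.r * (L / Real.sqrt t.r) ^ 2) / 16 = -L ^ 2 / 16 := by
      rw [div_pow, Real.sq_sqrt hr'.le]; field_simp
    rw [he] at h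
    refine (congrArg _ ?_).trans_le h
    ext z
    simp only [Set.mem_ofPred_eq, hu' x y z 0, hv' x y z 0]
    rfl

theorem sampleLaw_not_regular_le {D : Measure ℝ} (hD : IsDesignLaw D c.b) (hσ : 0 < c.σ)
    (hτ : 0 < c.τ) (hn : 0 < t.n) (hr : 0 < t.r) {L : ℝ} (hL : 0 < L) (hLr : L ≤ Real.sqrt t.r)
    (θ₀ : Fin t.p → ℝ) :
    t.sampleLaw c D {ω | ¬ ω.Regular c θ₀ L} ≤
      (t.p : ENNReal) ^ 2 * ENNReal.ofReal (2 * Real.exp (-L ^ 2 / (2 * (c.b ^ 2 + 1) ^ 2))) +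
      t.p * ENNReal.ofReal (2 * Real.exp (-L ^ 2 / (2 * c.b ^ 2))) +
      ((t.p : ENNReal) ^ 2 + 2 * t.p) * ENNReal.ofReal (4 * Real.exp (-L ^ 2 / 16)) := by
  have := hD.1
  have := isProbabilityMeasure_truncatedGaussian hσ hτ
  have : Nonempty (Fin t.n) := ⟨⟨0, hn⟩⟩
  set P := t.sampleLaw c D with hP
  have hN1 : P {ω | ¬ ∀ i j, |ω.1 i j| ≤ c.b} = 0 :=
    Measure.quasiMeasurePreserving_fst.ae hD.ae_pi_pi_le
  have hN2' : ∀ᵐ y ∂(Measure.pi fun _ : Fin t.n => truncatedGaussian c.σ c.τ),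
      ∀ i, |y i| ≤ c.τ :=
    eventually_all.2 fun i => (Measure.tendsto_eval_ae_ae
      (μ := fun _ : Fin t.n => truncatedGaussian c.σ c.τ)).eventually
        (ae_truncatedGaussian_abs_le c.σ c.τ)
  have hN2 : P {ω | ¬ ∀ i, |ω.2.1 i| ≤ c.τ} = 0 :=
    Measure.quasiMeasurePreserving_snd.ae (Measure.quasiMeasurePreserving_fst.ae hN2')
  have hE1 : ∀ j k : Fin t.p, P {ω | Real.sqrt t.n * L <
      |∑ i, (ω.1 i j * ω.1 i k - if j = k then 1 else 0)|} ≤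
      ENNReal.ofReal (2 * Real.exp (-L ^ 2 / (2 * (c.b ^ 2 + 1) ^ 2))) := by
    intro j k
    refine prod_prod_measure_le_of_slice₁ (measurableSet_lt (by fun_prop) (by fun_prop))
      (Eventually.of_forall fun y z => ?_)
    have h := hD.gram_deviation (ι := Fin t.n) j k hL.le
    rw [Fintype.card_fin] at h
    exact h
  have hE2 : ∀ j : Fin t.p, P {ω | Real.sqrt t.n * L * c.τ < |∑ i, ω.1 i j * ω.2.1 i|} ≤
      ENNReal.ofReal (2 * Real.exp (-L ^ 2 / (2 * c.b ^ 2))) := by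
    intro j
    refine prod_prod_measure_le_of_slice₁ (measurableSet_lt (by fun_prop) (by fun_prop))
      (hN2'.mono fun y hy z => ?_)
    have h := hD.noise_deviation (ι := Fin t.n) hτ hy j hL.le
    rw [Fintype.card_fin] at h
    exact h
  have hF := fun u v => sampleLaw_form_deviation (t := t) c hD hσ hτ hr hL hLr u v
  have hE3 := fun j k : Fin t.p => hF (fun ω => ω.col c j) (fun ω => ω.col c k)
    (measurable_col c j) (measurable_col c k) (fun _ _ _ _ => rfl) (fun _ _ _ _ => rfl)
  have hE4 := fun j : Fin t.p => hF (fun ω => ω.col c j) (fun _ => shift θ₀)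
    (measurable_col c j) (fun _ => measurable_const) (fun _ _ _ _ => rfl) (fun _ _ _ _ => rfl)
  have hE5 := fun j : Fin t.p => hF (fun ω => ω.col c j) (fun ω => ω.noise c θ₀)
    (measurable_col c j) (measurable_noise c θ₀) (fun _ _ _ _ => rfl) (fun _ _ _ _ => rfl)
  have hU : ∀ (S : Fin t.p → Set t.Sample) (q : ENNReal), (∀ j, P (S j) ≤ q) →
      P (⋃ j, S j) ≤ t.p * q := by
    intro S q hS
    refine (measure_iUnion_fintype_le P S).trans ((Finset.sum_le_sum fun j _ => hS j).trans_eq ?_)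
    simp
  have hU2 : ∀ (S : Fin t.p → Fin t.p → Set t.Sample) (q : ENNReal), (∀ j k, P (S j k) ≤ q) →
      P (⋃ j, ⋃ k, S j k) ≤ (t.p : ENNReal) ^ 2 * q := by
    intro S q hS
    refine (hU _ _ fun j => hU _ _ fun k => hS j k).trans_eq ?_
    rw [sq, mul_assoc]
  have hsub : {ω : t.Sample | ¬ ω.Regular c θ₀ L} ⊆
      (({ω | ¬ ∀ i j, |ω.1 i j| ≤ c.b} ∪ {ω | ¬ ∀ i, |ω.2.1 i| ≤ c.τ}) ∪
      (⋃ j, ⋃ k, {ω | Real.sqrt t.n * L <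
        |∑ i, (ω.1 i j * ω.1 i k - if j = k then 1 else 0)|}) ∪
      (⋃ j, {ω | Real.sqrt t.n * L * c.τ < |∑ i, ω.1 i j * ω.2.1 i|})) ∪
      ((⋃ j, ⋃ k, {ω | L / Real.sqrt t.r * (Real.sqrt (normSq (ω.col c j)) *
          Real.sqrt (normSq (ω.col c k))) <
          |ω.form (ω.col c j) (ω.col c k) - ∑ l, ω.col c j l * ω.col c k l|}) ∪
      ((⋃ j, {ω | L / Real.sqrt t.r * (Real.sqrt (normSq (ω.col c j)) *
          Real.sqrt (normSq (shift θ₀))) <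
          |ω.form (ω.col c j) (shift θ₀) - ∑ l, ω.col c j l * shift θ₀ l|}) ∪
      (⋃ j, {ω | L / Real.sqrt t.r * (Real.sqrt (normSq (ω.col c j)) *
          Real.sqrt (normSq (ω.noise c θ₀))) <
          |ω.form (ω.col c j) (ω.noise c θ₀) - ∑ l, ω.col c j l * ω.noise c θ₀ l|}))) := by
    intro ω hω
    by_contra hcon
    simp only [Set.mem_union, Set.mem_ofPred_eq, Set.mem_iUnion, not_or, not_exists, not_not,
      not_lt] at hcon
    obtain ⟨⟨⟨⟨h1, h2⟩, h3⟩, h4⟩, h5, h6, h7⟩ := hcon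
    exact hω ⟨h1, h2, h3, h4, h5, h6, h7⟩
  refine (measure_mono hsub).trans ?_
  refine (measure_union_le _ _).trans (add_le_add ?_ ?_)
  · refine (measure_union_le _ _).trans (add_le_add ?_ (hU _ _ hE2))
    refine (measure_union_le _ _).trans ?_
    have h0 : P ({ω | ¬ ∀ i j, |ω.1 i j| ≤ c.b} ∪ {ω | ¬ ∀ i, |ω.2.1 i| ≤ c.τ}) = 0 :=
      measure_union_null hN1 hN2
    rw [h0, zero_add]
    exact hU2 _ _ hE1
  · rw [add_mul]
    refine (measure_union_le _ _).trans (add_le_add (hU2 _ _ hE3) ?_)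
    refine (measure_union_le _ _).trans ((add_le_add (hU _ _ hE4) (hU _ _ hE5)).trans_eq ?_)
    ring

end ParamTuple

/-- By Cauchy–Schwarz `‖h‖₁² ≤ p ‖h‖₂²`, so an entrywise error `e` costs the quadratic form at most
`p e ‖h‖₂² ≤ ‖h‖₂² / 2`; this replaces a restricted eigenvalue condition. The linear coefficient `Z`
is close to `-v θ₀`, the ridge-type shrinkage caused by privatization, which costs `v ‖h‖₂` since
`θ₀` is a unit vector. Dividing by `‖h‖₂` bounds the ℓ² norm, and Cauchy–Schwarz once more gives the
ℓ¹ norm. -/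
theorem l1_le_of_basic_inequality {p : ℕ} {S : Fin p → Fin p → ℝ} {Z h θ₀ : Fin p → ℝ}
    {lam v e G : ℝ} (hS : ∀ j k, |S j k - if j = k then 1 + v else 0| ≤ e)
    (hZ : ∀ j, |Z j + v * θ₀ j| ≤ G) (hθ : ∑ j, θ₀ j ^ 2 = 1) (hv : 0 ≤ v) (hlam : 0 ≤ lam)
    (he : 0 ≤ e) (hG : 0 ≤ G) (hpe : p * e ≤ 1 / 2)
    (hopt : 1 / 2 * ∑ j, ∑ k, S j k * (h j * h k) + ∑ j, Z j * h j ≤ lam * ∑ j, |h j|) :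
    ∑ j, |h j| ≤ 4 * (p * (lam + G) + Real.sqrt p * v) := by
  set N1 := ∑ j, |h j| with hN1
  set N2 := ∑ j, h j ^ 2 with hN2
  have hN20 : 0 ≤ N2 := Finset.sum_nonneg fun _ _ => sq_nonneg _
  have hN10 : 0 ≤ N1 := Finset.sum_nonneg fun _ _ => abs_nonneg _
  have hcs : N1 ^ 2 ≤ p * N2 := by
    have := sq_sum_le_card_mul_sum_sq (s := Finset.univ) (f := fun j => |h j|)
    simpa [sq_abs] using this
  have hN := Real.sq_sqrt hN20
  have hN0 := Real.sqrt_nonneg N2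
  set N := Real.sqrt N2
  have hp := Real.sq_sqrt (Nat.cast_nonneg (α := ℝ) p)
  have hp0 := Real.sqrt_nonneg (p : ℝ)
  have hN1N : N1 ≤ Real.sqrt p * N := by
    refine abs_le_of_sq_le_sq' ?_ (by positivity) |>.2
    rw [mul_pow, hp, hN]; exact hcs
  have hquad : (1 + v) * N2 - e * N1 ^ 2 ≤ ∑ j, ∑ k, S j k * (h j * h k) := by
    have h1 : e * N1 ^ 2 = ∑ j, ∑ k, e * (|h j| * |h k|) := by
      rw [sq, hN1, Finset.sum_mul_sum, Finset.mul_sum]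
      exact Finset.sum_congr rfl fun j _ => by rw [Finset.mul_sum]
    have h2 : (1 + v) * N2 = ∑ j, ∑ k, (if j = k then 1 + v else 0) * (h j * h k) := by
      rw [hN2, Finset.mul_sum]
      refine Finset.sum_congr rfl fun j _ => ?_
      simp [sq]
    rw [h1, h2, ← Finset.sum_sub_distrib]
    refine Finset.sum_le_sum fun j _ => ?_
    rw [← Finset.sum_sub_distrib]
    refine Finset.sum_le_sum fun k _ => ?_
    have h3 : |(S j k - if j = k then 1 + v else 0) * (h j * h k)| ≤ e * (|h j| * |h k|) := by
      rw [abs_mul, abs_mul]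
      exact mul_le_mul_of_nonneg_right (hS j k) (by positivity)
    have := (abs_le.mp h3).1
    linarith
  have hdot : |∑ j, θ₀ j * h j| ≤ N := by
    refine abs_le_of_sq_le_sq ?_ hN0
    have := Finset.sum_mul_sq_le_sq_mul_sq Finset.univ θ₀ h
    rw [hθ, one_mul] at this
    rw [hN]; exact this
  have hlin : -(G * N1) - v * N ≤ ∑ j, Z j * h j := by
    have h1 : ∑ j, Z j * h j = ∑ j, (Z j + v * θ₀ j) * h j - v * ∑ j, θ₀ j * h j := by
      rw [Finset.mul_sum, ← Finset.sum_sub_distrib]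
      exact Finset.sum_congr rfl fun j _ => by ring
    have h2 : |∑ j, (Z j + v * θ₀ j) * h j| ≤ G * N1 := by
      refine (Finset.abs_sum_le_sum_abs _ _).trans ?_
      rw [hN1, Finset.mul_sum]
      refine Finset.sum_le_sum fun j _ => ?_
      rw [abs_mul]
      exact mul_le_mul_of_nonneg_right (hZ j) (abs_nonneg _)
    have h3 := (abs_le.mp h2).1
    have h4 := mul_le_mul_of_nonneg_left (abs_le.mp hdot).2 hv
    rw [h1]; linarith
  have h5 : e * N1 ^ 2 ≤ 1 / 2 * N2 := by
    calc e * N1 ^ 2 ≤ e * (p * N2) := mul_le_mul_of_nonneg_left hcs he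
      _ = p * e * N2 := by ring
      _ ≤ 1 / 2 * N2 := mul_le_mul_of_nonneg_right hpe hN20
  have h6 : 1 / 4 * N2 ≤ (lam + G) * N1 + v * N := by
    nlinarith [mul_nonneg hv hN20]
  have h7 : N ≤ 4 * ((lam + G) * Real.sqrt p + v) := by
    rcases hN0.eq_or_lt with h0 | h0
    · rw [← h0]; positivity
    · have h8 : (lam + G) * N1 ≤ (lam + G) * (Real.sqrt p * N) :=
        mul_le_mul_of_nonneg_left hN1N (by positivity)
      have h9 : N * N ≤ (4 * ((lam + G) * Real.sqrt p + v)) * N := by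
        rw [← sq, hN]; linarith
      exact le_of_mul_le_mul_right h9 h0
  calc N1 ≤ Real.sqrt p * N := hN1N
    _ ≤ Real.sqrt p * (4 * ((lam + G) * Real.sqrt p + v)) := mul_le_mul_of_nonneg_left h7 hp0
    _ = 4 * (Real.sqrt p ^ 2 * (lam + G) + Real.sqrt p * v) := by ring
    _ = _ := by rw [hp]

/-! ### Deterministic analysis of the private Lasso on the regular event. -/

namespace ParamTuple

variable {t : ParamTuple} (c : ModelConsts)

theorem Sample.form_eq (ω : t.Sample) (u v : t.Cols → ℝ) :
    ω.form u v = ω.R.mulVec u ⬝ᵥ ω.R.mulVec v := rfl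

theorem Sample.privX_apply (ω : t.Sample) (θ₀ : Fin t.p → ℝ) (i : Fin t.r) (j : Fin t.p) :
    ω.privX c θ₀ i j = ω.R.mulVec (ω.col c j) i := by
  simp only [Sample.privX, Sample.release, Matrix.toCols₁_apply, Matrix.mul_apply,
    Matrix.mulVec, dotProduct]
  refine Finset.sum_congr rfl fun l _ => ?_
  congr 1
  rcases l with i | k | u
  · simp [Sample.col, Sample.X]
  · simp [Sample.col, Matrix.one_apply]
  · simp [Sample.col]

/-- The private data again follow a linear model with coefficient `θ₀`. The block `wI` puts `w θ₀`
into `X* θ₀`, which the effective noise `[ξ; -wθ₀; w]` has to cancel. -/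
theorem Sample.privy_apply (ω : t.Sample) (θ₀ : Fin t.p → ℝ) (i : Fin t.r) :
    ω.privy c θ₀ i = ∑ j, ω.R.mulVec (ω.col c j) i * θ₀ j + ω.R.mulVec (ω.noise c θ₀) i := by
  have h : ∑ j, ω.R.mulVec (ω.col c j) i * θ₀ j =
      ω.R.mulVec (∑ j, θ₀ j • ω.col c j) i := by
    rw [Matrix.mulVec_sum, Finset.sum_apply]
    refine Finset.sum_congr rfl fun j _ => ?_
    rw [Matrix.mulVec_smul, Pi.smul_apply, smul_eq_mul, mul_comm]
  rw [h, ← Pi.add_apply, ← Matrix.mulVec_add]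
  simp only [Sample.privy, Sample.release, Matrix.mul_apply, Matrix.mulVec, dotProduct]
  refine Finset.sum_congr rfl fun l _ => ?_
  congr 1
  rcases l with i | k | u
  · simp [Sample.col, Sample.y, Sample.X, Sample.ξ, Sample.noise, Matrix.mulVec, dotProduct,
      mul_comm]
  · simp [Sample.col, Sample.noise, mul_comm]
  · simp [Sample.col, Sample.noise]

theorem Sample.lassoObjective_eq (ω : t.Sample) (θ₀ θ : Fin t.p → ℝ) (C : ℝ) :
    ω.lassoObjective c θ₀ C θ = 1 / (2 * t.n) *
      (∑ j, ∑ k, ω.form (ω.col c j) (ω.col c k) * ((θ₀ j - θ j) * (θ₀ k - θ k)) +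
        2 * ∑ j, ω.form (ω.col c j) (ω.noise c θ₀) * (θ₀ j - θ j) +
        ω.form (ω.noise c θ₀) (ω.noise c θ₀)) + t.penalty c C * ∑ j, |θ j| := by
  have hres : ∀ i, (ω.privX c θ₀).mulVec θ i - ω.privy c θ₀ i =
      -(∑ j, (θ₀ j - θ j) * ω.R.mulVec (ω.col c j) i + ω.R.mulVec (ω.noise c θ₀) i) := by
    intro i
    have h1 : (ω.privX c θ₀).mulVec θ i = ∑ j, ω.R.mulVec (ω.col c j) i * θ j := by
      simp only [Matrix.mulVec, dotProduct]
      exact Finset.sum_congr rfl fun j _ => by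
        rw [Sample.privX_apply]; rfl
    rw [h1, Sample.privy_apply]
    simp only [sub_mul, Finset.sum_sub_distrib]
    simp only [mul_comm (θ₀ _), mul_comm (θ _)]
    ring
  rw [Sample.lassoObjective]
  congr 2
  have h2 : ω.R.mulVec (∑ j, (θ₀ j - θ j) • ω.col c j + ω.noise c θ₀) =
      fun i => ∑ j, (θ₀ j - θ j) * ω.R.mulVec (ω.col c j) i + ω.R.mulVec (ω.noise c θ₀) i := by
    ext i
    rw [Matrix.mulVec_add, Matrix.mulVec_sum, Pi.add_apply, Finset.sum_apply]
    simp [Matrix.mulVec_smul]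
  have h3 : ∑ i, ((ω.privX c θ₀).mulVec θ i - ω.privy c θ₀ i) ^ 2 =
      ω.R.mulVec (∑ j, (θ₀ j - θ j) • ω.col c j + ω.noise c θ₀) ⬝ᵥ
      ω.R.mulVec (∑ j, (θ₀ j - θ j) • ω.col c j + ω.noise c θ₀) := by
    rw [h2]
    simp only [dotProduct, hres]
    exact Finset.sum_congr rfl fun i _ => by ring
  rw [h3]
  simp only [Sample.form_eq]
  rw [Matrix.mulVec_add, Matrix.mulVec_sum]
  simp only [Matrix.mulVec_smul, add_dotProduct, dotProduct_add, sum_dotProduct, dotProduct_sum,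
    smul_dotProduct, dotProduct_smul, smul_eq_mul, mul_add, Finset.sum_add_distrib]
  have h4 : ∑ j, (θ₀ j - θ j) * (ω.R.mulVec (ω.noise c θ₀) ⬝ᵥ ω.R.mulVec (ω.col c j)) =
      ∑ j, (ω.R.mulVec (ω.col c j) ⬝ᵥ ω.R.mulVec (ω.noise c θ₀)) * (θ₀ j - θ j) :=
    Finset.sum_congr rfl fun j _ => by rw [dotProduct_comm, mul_comm]
  have h5 : ∑ j, (θ₀ j - θ j) * (ω.R.mulVec (ω.col c j) ⬝ᵥ ω.R.mulVec (ω.noise c θ₀)) =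
      ∑ j, (ω.R.mulVec (ω.col c j) ⬝ᵥ ω.R.mulVec (ω.noise c θ₀)) * (θ₀ j - θ j) :=
    Finset.sum_congr rfl fun j _ => mul_comm _ _
  have h6 : ∑ j, (θ₀ j - θ j) * ∑ k, (θ₀ k - θ k) *
      (ω.R.mulVec (ω.col c k) ⬝ᵥ ω.R.mulVec (ω.col c j)) =
      ∑ j, ∑ k, (ω.R.mulVec (ω.col c j) ⬝ᵥ ω.R.mulVec (ω.col c k)) *
        ((θ₀ j - θ j) * (θ₀ k - θ k)) := by
    refine Finset.sum_congr rfl fun j _ => ?_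
    rw [Finset.mul_sum]
    refine Finset.sum_congr rfl fun k _ => ?_
    rw [dotProduct_comm]; ring
  rw [h4, h5, h6]
  ring

/-- Optimality is tested against `θ₀`. The term quadratic in the noise cancels, and the difference
of the penalties is at most the ℓ¹ error. -/
theorem Sample.IsLasso.basic_inequality {ω : t.Sample} {θ₀ θ : Fin t.p → ℝ} {C : ℝ}
    (hθ : ω.IsLasso c θ₀ C θ) (hpen : 0 ≤ t.penalty c C) :
    1 / 2 * ∑ j, ∑ k, 1 / (t.n : ℝ) * ω.form (ω.col c j) (ω.col c k) *
        ((θ₀ j - θ j) * (θ₀ k - θ k)) +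
      ∑ j, 1 / (t.n : ℝ) * ω.form (ω.col c j) (ω.noise c θ₀) * (θ₀ j - θ j) ≤
    t.penalty c C * ∑ j, |θ₀ j - θ j| := by
  have h := hθ θ₀
  rw [Sample.lassoObjective_eq, Sample.lassoObjective_eq] at h
  simp only [sub_self, mul_zero, Finset.sum_const_zero, zero_add] at h
  have h1 : ∑ j, |θ₀ j| - ∑ j, |θ j| ≤ ∑ j, |θ₀ j - θ j| := by
    rw [← Finset.sum_sub_distrib]
    exact Finset.sum_le_sum fun j _ => abs_sub_abs_le_abs_sub _ _
  have h2 := mul_le_mul_of_nonneg_left h1 hpen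
  simp only [mul_assoc, ← Finset.mul_sum]
  have h3 : (1 : ℝ) / (2 * t.n) = 1 / 2 * (1 / t.n) := by rw [one_div_mul_one_div]
  rw [h3] at h
  linarith

/-- The identity `-wθ = w(θ₀ - θ) - wθ₀` turns `[X(θ₀ - θ); -wθ; w]` into a combination of the
columns of `[X; wI; 0]` plus `w [0; -θ₀; 1]`. Thus `θ` enters only through the coefficients `θ₀ -
θ`, and the remaining forms are controlled by regularity. -/
theorem Sample.bias_apply (ω : t.Sample) (θ₀ θ : Fin t.p → ℝ) (j : Fin t.p) (hn : 0 < t.n) :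
    ω.bias c θ₀ θ j =
      ∑ k, 1 / (t.n : ℝ) * (∑ i, (ω.1 i j * ω.1 i k - if j = k then 1 else 0)) * (θ₀ k - θ k) +
      (∑ k, 1 / (t.n : ℝ) * (ω.form (ω.col c j) (ω.col c k) - ∑ l, ω.col c j l * ω.col c k l) *
        (θ₀ k - θ k) +
      1 / (t.n : ℝ) * t.w c *
        (ω.form (ω.col c j) (shift θ₀) - ∑ l, ω.col c j l * shift θ₀ l)) := by
  have hn' : (t.n : ℝ) ≠ 0 := by exact_mod_cast hn.ne'
  rw [Sample.bias, Pi.add_apply]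
  congr 1
  · rw [Matrix.mulVec, dotProduct]
    refine Finset.sum_congr rfl fun k _ => ?_
    rw [Pi.sub_apply]
    congr 1
    rw [Finset.sum_sub_distrib, Matrix.sub_apply, Matrix.smul_apply, Matrix.mul_apply,
      Matrix.one_apply, Finset.sum_const, Finset.card_univ, Fintype.card_fin, nsmul_eq_mul,
      mul_sub, ← mul_assoc, one_div_mul_cancel hn', one_mul]
    rfl
  · have hcol : (Matrix.fromCols ω.X.transpose
        (Matrix.fromCols (t.w c • (1 : Matrix (Fin t.p) (Fin t.p) ℝ))
          (0 : Matrix (Fin t.p) Unit ℝ))) j = ω.col c j := by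
      ext l
      rcases l with i | k | u
      · rfl
      · simp [Sample.col, Matrix.one_apply, eq_comm]
      · rfl
    have hu : Sum.elim (ω.X.mulVec (θ₀ - θ)) (Sum.elim (-(t.w c • θ)) (fun _ => t.w c)) =
        ∑ k, (θ₀ k - θ k) • ω.col c k + t.w c • shift θ₀ := by
      ext l
      rcases l with i | k | u
      · simp [Sample.col, shift, Matrix.mulVec, dotProduct, Sample.X, mul_comm]
      · simp [Sample.col, shift]; ring
      · simp [Sample.col, shift]
    rw [hu, Pi.smul_apply, ← Matrix.mulVec_mulVec, Matrix.mulVec, hcol,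
      Matrix.sub_mulVec, Matrix.one_mulVec, dotProduct_sub, ← Matrix.mulVec_mulVec,
      Matrix.dotProduct_mulVec, Matrix.vecMul_transpose, Matrix.mulVec_add, Matrix.mulVec_sum]
    simp only [Matrix.mulVec_smul, dotProduct_add, dotProduct_sum, dotProduct_smul, smul_eq_mul,
      Sample.form_eq]
    have h1 : ∀ v : t.Cols → ℝ, ∑ l, ω.col c j l * v l = ω.col c j ⬝ᵥ v := fun _ => rfl
    have h2 : (fun l => ω.col c j l) = ω.col c j := rfl
    simp only [h1, h2, mul_assoc, ← Finset.mul_sum, sub_mul, mul_sub, Finset.sum_sub_distrib]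
    simp only [mul_comm (θ₀ _), mul_comm (θ _)]
    ring

section Norms

variable (ω : t.Sample) (θ₀ : Fin t.p → ℝ)

theorem Sample.col_mul_col (j k : Fin t.p) : ∑ l, ω.col c j l * ω.col c k l =
    ∑ i, ω.1 i j * ω.1 i k + if j = k then t.w c ^ 2 else 0 := by
  rw [Fintype.sum_sum_type, Fintype.sum_sum_type]
  simp [Sample.col, sq, eq_comm]

theorem Sample.col_mul_noise (j : Fin t.p) : ∑ l, ω.col c j l * ω.noise c θ₀ l =
    ∑ i, ω.1 i j * ω.2.1 i - t.w c ^ 2 * θ₀ j := by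
  rw [Fintype.sum_sum_type, Fintype.sum_sum_type]
  simp [Sample.col, Sample.noise, sq]; ring

theorem normSq_shift (hθ : ∑ j, θ₀ j ^ 2 = 1) : normSq (shift θ₀) = 2 := by
  rw [normSq, Fintype.sum_sum_type, Fintype.sum_sum_type]
  simp [shift, hθ]; norm_num

theorem Sample.normSq_col_le {b : ℝ} (hb : ∀ i j, |ω.1 i j| ≤ b) (j : Fin t.p) :
    normSq (ω.col c j) ≤ t.n * b ^ 2 + t.w c ^ 2 := by
  rw [normSq, Fintype.sum_sum_type, Fintype.sum_sum_type]
  simp only [Sample.col, Sum.elim_inl, Sum.elim_inr, ite_pow, ne_eq, OfNat.ofNat_ne_zero,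
    not_false_eq_true, zero_pow, Finset.sum_ite_eq', Finset.mem_univ, if_true,
    Finset.sum_const_zero, add_zero]
  gcongr
  refine (Finset.sum_le_sum fun i _ => sq_le_sq.mpr ((hb i j).trans (le_abs_self b))).trans_eq ?_
  simp

theorem Sample.normSq_noise_le (hθ : ∑ j, θ₀ j ^ 2 = 1) {τ : ℝ} (hτ : ∀ i, |ω.2.1 i| ≤ τ) :
    normSq (ω.noise c θ₀) ≤ t.n * τ ^ 2 + 2 * t.w c ^ 2 := by
  rw [normSq, Fintype.sum_sum_type, Fintype.sum_sum_type]
  simp only [Sample.noise, Sum.elim_inl, Sum.elim_inr, neg_sq, mul_pow, ← Finset.mul_sum, hθ]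
  have h : ∑ i, ω.2.1 i ^ 2 ≤ t.n * τ ^ 2 := by
    refine (Finset.sum_le_sum fun i _ => sq_le_sq.mpr ((hτ i).trans (le_abs_self τ))).trans_eq ?_
    simp
  simp
  linarith

end Norms

/-- Regularity supplies the entrywise closeness to `(1 + w²/n) I` and to `-(w²/n) θ₀`. Since `w² ≤
n`, every column has norm at most `√n √(b² + 1)`. -/
theorem Sample.Regular.l1_error_le {ω : t.Sample} {θ₀ θ : Fin t.p → ℝ} {C L : ℝ}
    (hω : ω.Regular c θ₀ L) (hθ : ω.IsLasso c θ₀ C θ) (hpen : 0 ≤ t.penalty c C)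
    (hθ₀ : ∑ j, θ₀ j ^ 2 = 1) (hn : 0 < t.n) (hL : 0 ≤ L) (hτ : 0 ≤ c.τ)
    (hv : t.w c ^ 2 / t.n ≤ 1)
    (hpe : t.p * (L / Real.sqrt t.n + L / Real.sqrt t.r * (c.b ^ 2 + 1)) ≤ 1 / 2) :
    ∑ j, |θ₀ j - θ j| ≤ 4 * (t.p * (t.penalty c C + (L * c.τ / Real.sqrt t.n +
      L / Real.sqrt t.r * (Real.sqrt (c.b ^ 2 + 1) *
        Real.sqrt (c.τ ^ 2 + 2 * (t.w c ^ 2 / t.n))))) +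
      Real.sqrt t.p * (t.w c ^ 2 / t.n)) := by
  have hn' : (0 : ℝ) < t.n := by exact_mod_cast hn
  have hsn := Real.sqrt_pos.mpr hn'
  have hs2 := Real.mul_self_sqrt hn'.le
  have hw : t.w c ^ 2 ≤ t.n := by rwa [div_le_one hn'] at hv
  have hcol : ∀ j, Real.sqrt (normSq (ω.col c j)) ≤ Real.sqrt t.n * Real.sqrt (c.b ^ 2 + 1) := by
    intro j
    rw [← Real.sqrt_mul hn'.le]
    exact Real.sqrt_le_sqrt ((ω.normSq_col_le c hω.abs_design_le j).trans (by linarith))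
  have hnoise : Real.sqrt (normSq (ω.noise c θ₀)) ≤
      Real.sqrt t.n * Real.sqrt (c.τ ^ 2 + 2 * (t.w c ^ 2 / t.n)) := by
    rw [← Real.sqrt_mul hn'.le]
    refine Real.sqrt_le_sqrt ((ω.normSq_noise_le c θ₀ hθ₀ hω.abs_noise_le).trans_eq ?_)
    field_simp
  have hdiv : Real.sqrt t.n * L / t.n = L / Real.sqrt t.n := by
    rw [div_eq_div_iff hn'.ne' hsn.ne']
    linear_combination L * hs2
  refine l1_le_of_basic_inequality (fun j k => ?_) (fun j => ?_) hθ₀ (by positivity) hpen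
    (by positivity) (by positivity) hpe (hθ.basic_inequality c hpen)
  · have h1 := hω.form_col j k
    have h2 := hω.gram j k
    rw [Sample.col_mul_col] at h1
    have h3 : (1 / (t.n : ℝ) * ω.form (ω.col c j) (ω.col c k) -
        if j = k then 1 + t.w c ^ 2 / t.n else 0) =
        ((ω.form (ω.col c j) (ω.col c k) - (∑ i, ω.1 i j * ω.1 i k +
          if j = k then t.w c ^ 2 else 0)) +
        ∑ i, (ω.1 i j * ω.1 i k - if j = k then 1 else 0)) / t.n := by
      rw [Finset.sum_sub_distrib, Finset.sum_const, Finset.card_univ, Fintype.card_fin,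
        nsmul_eq_mul]
      split_ifs <;> field_simp <;> ring
    rw [h3, abs_div, abs_of_pos hn', div_le_iff₀ hn']
    refine (abs_add_le _ _).trans ((add_le_add (h1.trans (mul_le_mul_of_nonneg_left
      (mul_le_mul (hcol j) (hcol k) (Real.sqrt_nonneg _) (by positivity)) (by positivity)))
      h2).trans_eq ?_)
    have h4 := Real.mul_self_sqrt (by positivity : 0 ≤ c.b ^ 2 + 1)
    rw [add_mul, ← hdiv, div_mul_cancel₀ _ hn'.ne']
    linear_combination L / Real.sqrt t.r * (c.b ^ 2 + 1) * hs2 +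
      L / Real.sqrt t.r * (Real.sqrt t.n * Real.sqrt t.n) * h4
  · have h1 := hω.form_noise j
    have h2 := hω.corr j
    rw [Sample.col_mul_noise] at h1
    have h3 : 1 / (t.n : ℝ) * ω.form (ω.col c j) (ω.noise c θ₀) + t.w c ^ 2 / t.n * θ₀ j =
        ((ω.form (ω.col c j) (ω.noise c θ₀) - (∑ i, ω.1 i j * ω.2.1 i - t.w c ^ 2 * θ₀ j)) +
          ∑ i, ω.1 i j * ω.2.1 i) / t.n := by
      field_simp; ring
    rw [h3, abs_div, abs_of_pos hn', div_le_iff₀ hn']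
    refine (abs_add_le _ _).trans ((add_le_add (h1.trans (mul_le_mul_of_nonneg_left
      (mul_le_mul (hcol j) hnoise (Real.sqrt_nonneg _) (by positivity)) (by positivity)))
      h2).trans_eq ?_)
    have h5 : L * c.τ / Real.sqrt t.n * t.n = Real.sqrt t.n * L * c.τ := by
      rw [mul_div_right_comm, ← hdiv]; field_simp
    rw [add_mul, h5]
    linear_combination L / Real.sqrt t.r * (Real.sqrt (c.b ^ 2 + 1) *
      Real.sqrt (c.τ ^ 2 + 2 * (t.w c ^ 2 / t.n))) * hs2

/-- Hölder's inequality in each coordinate: uniformly small coefficients against the ℓ¹ error, plus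
the term in `[0; -θ₀; 1]`, whose norm is `√2`. -/
theorem Sample.Regular.norm_bias_le {ω : t.Sample} {θ₀ θ : Fin t.p → ℝ} {L : ℝ}
    (hω : ω.Regular c θ₀ L) (hθ₀ : ∑ j, θ₀ j ^ 2 = 1) (hn : 0 < t.n) (hL : 0 ≤ L)
    (hv : t.w c ^ 2 / t.n ≤ 1) :
    ‖ω.bias c θ₀ θ‖ ≤ (L / Real.sqrt t.n + L / Real.sqrt t.r * (c.b ^ 2 + 1)) *
      ∑ j, |θ₀ j - θ j| + L / Real.sqrt t.r * (Real.sqrt (c.b ^ 2 + 1) *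
        Real.sqrt (2 * (t.w c ^ 2 / t.n))) := by
  have hn' : (0 : ℝ) < t.n := by exact_mod_cast hn
  have hsn := Real.sqrt_pos.mpr hn'
  have hs2 := Real.mul_self_sqrt hn'.le
  have hw : t.w c ^ 2 ≤ t.n := by rwa [div_le_one hn'] at hv
  have hw0 : 0 ≤ t.w c := Real.sqrt_nonneg _
  have hcol : ∀ j, Real.sqrt (normSq (ω.col c j)) ≤ Real.sqrt t.n * Real.sqrt (c.b ^ 2 + 1) := by
    intro j
    rw [← Real.sqrt_mul hn'.le]
    exact Real.sqrt_le_sqrt ((ω.normSq_col_le c hω.abs_design_le j).trans (by linarith))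
  have hdiv : 1 / (t.n : ℝ) * (Real.sqrt t.n * L) = L / Real.sqrt t.n := by
    rw [← mul_div_right_comm, one_mul, div_eq_div_iff hn'.ne' hsn.ne']
    linear_combination L * hs2
  have h4 := Real.mul_self_sqrt (by positivity : 0 ≤ c.b ^ 2 + 1)
  rw [pi_norm_le_iff_of_nonneg (by positivity)]
  intro j
  rw [Real.norm_eq_abs, Sample.bias_apply c ω θ₀ θ j hn, add_mul, add_assoc]
  have hsum : ∀ (f : Fin t.p → ℝ) (q : ℝ), (∀ k, |1 / (t.n : ℝ) * f k| ≤ q) →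
      |∑ k, 1 / (t.n : ℝ) * f k * (θ₀ k - θ k)| ≤ q * ∑ j, |θ₀ j - θ j| := by
    intro f q hf
    refine (Finset.abs_sum_le_sum_abs _ _).trans ?_
    rw [Finset.mul_sum]
    refine Finset.sum_le_sum fun k _ => ?_
    rw [abs_mul]
    exact mul_le_mul_of_nonneg_right (hf k) (abs_nonneg _)
  refine (abs_add_le _ _).trans (add_le_add (hsum _ _ fun k => ?_)
    ((abs_add_le _ _).trans (add_le_add (hsum _ _ fun k => ?_) ?_)))
  · rw [abs_mul, abs_of_pos (by positivity), ← hdiv]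
    exact mul_le_mul_of_nonneg_left (hω.gram j k) (by positivity)
  · rw [abs_mul, abs_of_pos (by positivity)]
    refine (mul_le_mul_of_nonneg_left ((hω.form_col j k).trans (mul_le_mul_of_nonneg_left
      (mul_le_mul (hcol j) (hcol k) (Real.sqrt_nonneg _) (by positivity)) (by positivity)))
      (by positivity : 0 ≤ 1 / (t.n : ℝ))).trans_eq ?_
    rw [one_div_mul_eq_div, div_eq_iff hn'.ne']
    linear_combination L / Real.sqrt t.r * (c.b ^ 2 + 1) * hs2 +
      L / Real.sqrt t.r * (Real.sqrt t.n * Real.sqrt t.n) * h4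
  · rw [abs_mul, abs_of_nonneg (by positivity)]
    have h5 := hω.form_shift j
    rw [normSq_shift θ₀ hθ₀] at h5
    refine (mul_le_mul_of_nonneg_left (h5.trans (mul_le_mul_of_nonneg_left
      (mul_le_mul_of_nonneg_right (hcol j) (Real.sqrt_nonneg _)) (by positivity)))
      (by positivity)).trans_eq ?_
    rw [Real.sqrt_mul (by norm_num : (0 : ℝ) ≤ 2), Real.sqrt_div (sq_nonneg _), Real.sqrt_sq hw0]
    field_simp
    rw [Real.sq_sqrt hn'.le]
    ring

end ParamTuple

/-! ### Calculus of polynomial growth exponents. -/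

/-- `f p` grows at most like `p ^ a`, up to factors `p ^ o(1)`. -/
def PolyGrowth (f : ℕ → ℝ) (a : ℝ) : Prop :=
  ∀ a' > a, f =O[atTop] fun p : ℕ => (p : ℝ) ^ a'

namespace PolyGrowth

variable {f g : ℕ → ℝ} {a a' : ℝ}

theorem mono (hf : PolyGrowth f a) (h : a ≤ a') : PolyGrowth f a' :=
  fun _ hx => hf _ (h.trans_lt hx)

theorem of_isBigO (h : f =O[atTop] g) (hg : PolyGrowth g a) : PolyGrowth f a :=
  fun x hx => h.trans (hg x hx)

theorem of_abs_le (hg : PolyGrowth g a) (h : ∀ᶠ p in atTop, |f p| ≤ |g p|) : PolyGrowth f a :=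
  of_isBigO (IsBigO.of_bound 1 (h.mono fun p hp => by simpa using hp)) hg

theorem of_nonneg_le (hg : PolyGrowth g a) (h0 : ∀ᶠ p in atTop, 0 ≤ f p)
    (h : ∀ᶠ p in atTop, f p ≤ g p) : PolyGrowth f a :=
  hg.of_abs_le (by
    filter_upwards [h0, h] with p (h1 : 0 ≤ f p) (h2 : f p ≤ g p)
    rw [abs_of_nonneg h1]; exact h2.trans (le_abs_self _))

theorem of_isBigO_rpow (h : f =O[atTop] fun p : ℕ => (p : ℝ) ^ a) : PolyGrowth f a := by
  intro x hx
  refine h.trans (IsBigO.of_bound 1 ?_)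
  filter_upwards [eventually_ge_atTop 1] with p hp
  have hp' : (1 : ℝ) ≤ p := by exact_mod_cast hp
  rw [Real.norm_of_nonneg (by positivity), Real.norm_of_nonneg (by positivity), one_mul]
  exact Real.rpow_le_rpow_of_exponent_le hp' hx.le

theorem const (k : ℝ) : PolyGrowth (fun _ => k) 0 :=
  of_isBigO_rpow (by simpa using isBigO_const_const k (one_ne_zero : (1 : ℝ) ≠ 0) (atTop : Filter ℕ))

theorem natCast_rpow (a : ℝ) : PolyGrowth (fun p => (p : ℝ) ^ a) a :=
  of_isBigO_rpow (isBigO_refl _ _)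

theorem natCast : PolyGrowth (fun p => (p : ℝ)) 1 := by
  simpa using natCast_rpow 1

theorem log : PolyGrowth (fun p => Real.log p) 0 :=
  fun _ hx => ((isLittleO_log_rpow_atTop hx).comp_tendsto tendsto_natCast_atTop_atTop).isBigO

theorem mul {b : ℝ} (hf : PolyGrowth f a) (hg : PolyGrowth g b) :
    PolyGrowth (fun p => f p * g p) (a + b) := by
  intro x hx
  have h1 := (hf (a + (x - (a + b)) / 2) (by linarith)).mul
    (hg (b + (x - (a + b)) / 2) (by linarith))
  refine h1.trans_eventuallyEq ?_
  filter_upwards [eventually_ge_atTop 1] with p hp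
  have hp' : (0 : ℝ) < p := by exact_mod_cast hp
  rw [← Real.rpow_add hp']
  congr 1; ring

theorem add (hf : PolyGrowth f a) (hg : PolyGrowth g a) :
    PolyGrowth (fun p => f p + g p) a :=
  fun x hx => (hf x hx).add (hg x hx)

theorem max (hf : PolyGrowth f a) (hg : PolyGrowth g a) :
    PolyGrowth (fun p => Max.max (f p) (g p)) a := by
  intro x hx
  refine (IsBigO.of_norm_le (g := fun p => ‖f p‖ + ‖g p‖) fun p => ?_).trans
    ((hf x hx).norm_left.add (hg x hx).norm_left)
  simp only [Real.norm_eq_abs]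
  exact (abs_max_le_max_abs_abs).trans
    (max_le (by linarith [abs_nonneg (g p)]) (by linarith [abs_nonneg (f p)]))

theorem const_mul (k : ℝ) (hf : PolyGrowth f a) : PolyGrowth (fun p => k * f p) a :=
  fun x hx => (hf x hx).const_mul_left k

theorem pow (hf : PolyGrowth f a) (m : ℕ) : PolyGrowth (fun p => f p ^ m) (m * a) := by
  induction m with
  | zero => simpa using const 1
  | succ m ih =>
    simp only [pow_succ]
    convert ih.mul hf using 1
    push_cast; ring

theorem sqrt (hf : PolyGrowth f a) : PolyGrowth (fun p => Real.sqrt (f p)) (a / 2) := by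
  intro x hx
  obtain ⟨k, hk0, hk⟩ := (hf (2 * x) (by linarith)).exists_nonneg
  refine IsBigO.of_bound (Real.sqrt k) ?_
  filter_upwards [hk.bound] with p hp
  rw [Real.norm_of_nonneg (Real.sqrt_nonneg _), Real.norm_of_nonneg (by positivity)]
  rw [Real.norm_eq_abs, (Real.norm_of_nonneg (by positivity) :
    ‖(p : ℝ) ^ (2 * x)‖ = (p : ℝ) ^ (2 * x))] at hp
  refine (Real.sqrt_le_sqrt ((le_abs_self _).trans hp)).trans_eq ?_
  rw [Real.sqrt_mul hk0, Real.sqrt_eq_rpow ((p : ℝ) ^ (2 * x)), ← Real.rpow_mul (Nat.cast_nonneg p)]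
  congr 2; ring

theorem tendsto_zero (hf : PolyGrowth f a) (ha : a < 0) : Tendsto f atTop (𝓝 0) := by
  refine (hf (a / 2) (by linarith)).trans_tendsto ?_
  have h := (tendsto_rpow_neg_atTop (y := -(a / 2)) (by linarith)).comp
    (tendsto_natCast_atTop_atTop (R := ℝ))
  simpa [Function.comp_def] using h

theorem eventually_le (hf : PolyGrowth f a) (ha : a < 0) {η : ℝ} (hη : 0 < η) :
    ∀ᶠ p in atTop, f p ≤ η :=
  ((hf.tendsto_zero ha).eventually_lt_const hη).mono fun _ h => h.le

end PolyGrowth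

theorem isLittleO_of_eventually_le_mul {f g h : ℕ → ℝ} (hh : Tendsto h atTop (𝓝 0))
    (hf : ∀ᶠ p in atTop, 0 ≤ f p) (hle : ∀ᶠ p in atTop, f p ≤ h p * g p) : f =o[atTop] g := by
  have h1 : (fun p => h p * g p) =o[atTop] g := by
    simpa using ((isLittleO_one_iff ℝ).mpr hh).mul_isBigO (isBigO_refl g atTop)
  refine IsBigO.trans_isLittleO (IsBigO.of_bound 1 ?_) h1
  filter_upwards [hf, hle] with p h2 h3
  rw [one_mul, Real.norm_of_nonneg h2]
  exact h3.trans (le_abs_self _)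

/-- `exp(-log² p / K) = p ^ (-log p / K)` beats every power of `p`, whatever `K`. This is why the
deviation level `log p` works for every `b`. -/
theorem tendsto_natCast_pow_mul_exp_neg_log_sq (m : ℕ) (k : ℝ) {K : ℝ} (hK : 0 < K) :
    Tendsto (fun p : ℕ => (p : ENNReal) ^ m *
      ENNReal.ofReal (k * Real.exp (-Real.log p ^ 2 / K))) atTop (𝓝 0) := by
  have hlog : Tendsto (fun p : ℕ => Real.log p) atTop atTop :=
    Real.tendsto_log_atTop.comp tendsto_natCast_atTop_atTop
  have h1 : Tendsto (fun x : ℝ => x * (x / K - m)) atTop atTop :=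
    tendsto_id.atTop_mul_atTop₀ (tendsto_atTop_add_const_right _ _ (tendsto_id.atTop_div_const hK))
  have h2 : Tendsto (fun p : ℕ => k * Real.exp (-(Real.log p * (Real.log p / K - m))))
      atTop (𝓝 0) := by
    simpa using (Real.tendsto_exp_neg_atTop_nhds_zero.comp (h1.comp hlog)).const_mul k
  have h3 := (ENNReal.tendsto_ofReal h2)
  rw [ENNReal.ofReal_zero] at h3
  refine h3.congr' ?_
  filter_upwards [eventually_ge_atTop 1] with p hp
  have hp' : (0 : ℝ) < p := by exact_mod_cast hp
  have h4 : (p : ENNReal) ^ m = ENNReal.ofReal ((p : ℝ) ^ m) := by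
    rw [ENNReal.ofReal_pow hp'.le, ENNReal.ofReal_natCast]
  have h5 : (p : ℝ) ^ m = Real.exp (m * Real.log p) := by
    rw [Real.exp_nat_mul, Real.exp_log hp']
  rw [h4, ← ENNReal.ofReal_mul (by positivity), h5, mul_left_comm, ← Real.exp_add]
  congr 3; ring

/-! ### Comparisons of the scales at a fixed large dimension. -/

namespace ParamTuple

/-- The non-asymptotic inequalities satisfied by the parameters for large dimension. -/
structure Admissible (t : ParamTuple) (c : ModelConsts) : Prop where
  one_le_log : 1 ≤ Real.log t.p
  n_pos : 0 < t.n
  r_pos : 0 < t.r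
  n_le_r : t.n ≤ t.r
  w_pos : 0 < t.w c
  w_sq_le : t.w c ^ 2 / t.n ≤ 1
  σ_pos : 0 < c.σ
  τ_pos : 0 < c.τ

variable {t : ParamTuple} {c : ModelConsts}

/-- The scale of the noise that the privatization adds to the bias. -/
noncomputable def privacyScale (t : ParamTuple) (c : ModelConsts) : ℝ :=
  max (t.w c * Real.log t.p / Real.sqrt (t.n * t.r))
    (t.w c ^ 2 / t.n * Real.sqrt (Real.log t.p / t.r))

namespace Admissible

variable (h : t.Admissible c)
include h

theorem n_pos' : (0 : ℝ) < t.n := by exact_mod_cast h.n_pos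
theorem r_pos' : (0 : ℝ) < t.r := by exact_mod_cast h.r_pos
theorem n_le_r' : (t.n : ℝ) ≤ t.r := by exact_mod_cast h.n_le_r

theorem log_pos : 0 < Real.log t.p := one_pos.trans_le h.one_le_log

theorem sqrt_log_le : Real.sqrt (Real.log t.p) ≤ Real.log t.p := by
  rw [Real.sqrt_le_left h.log_pos.le]
  nlinarith [h.one_le_log]

theorem one_le_phi : 1 ≤ t.phi c := by
  have := h.n_pos'
  unfold phi
  linarith [div_nonneg (sq_nonneg (t.w c)) this.le]

theorem inv_sqrt_n_le_rho : 1 / Real.sqrt t.n ≤ t.rho c := by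
  have hn := h.n_pos'
  have hr := h.r_pos'
  rw [one_div, ← Real.sqrt_inv]
  refine Real.sqrt_le_sqrt ?_
  have h1 : (t.n : ℝ)⁻¹ = t.r / (t.n * t.r) := by field_simp
  have h2 : (t.r : ℝ) / (t.n * t.r) ≤ (t.n + t.r + 1) / (t.n * t.r) := by
    gcongr; linarith
  have h3 : 0 ≤ t.w c ^ 2 / (t.n * t.r) := by positivity
  linarith

theorem rho_pos : 0 < t.rho c := by
  have hn := h.n_pos'
  exact lt_of_lt_of_le (by positivity) h.inv_sqrt_n_le_rho

theorem inv_rho_le : 1 / (c.σ * t.rho c) ≤ Real.sqrt t.n / c.σ := by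
  have hn := Real.sqrt_pos.mpr h.n_pos'
  have hσ := h.σ_pos
  have h1 : 1 / t.rho c ≤ Real.sqrt t.n := by
    rw [div_le_iff₀ h.rho_pos]
    have := (div_le_iff₀ hn).mp h.inv_sqrt_n_le_rho
    linarith
  calc 1 / (c.σ * t.rho c) = (1 / t.rho c) / c.σ := by rw [div_div, mul_comm]
    _ ≤ _ := div_le_div_of_nonneg_right h1 hσ.le

theorem le_penalty : c.σ / Real.sqrt t.n ≤ t.penalty c 1 := by
  have hn := h.n_pos'
  have hσ := h.σ_pos
  rw [penalty, one_mul, div_eq_mul_one_div]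
  refine mul_le_mul_of_nonneg_left ((le_max_left _ _).trans' ?_) hσ.le
  rw [one_div, ← Real.sqrt_inv, inv_eq_one_div]
  exact Real.sqrt_le_sqrt (div_le_div_of_nonneg_right h.one_le_log hn.le)

theorem penalty_pos : 0 < t.penalty c 1 := by
  have hn := h.n_pos'
  have hσ := h.σ_pos
  exact lt_of_lt_of_le (by positivity) h.le_penalty

theorem kappa_pos : 0 < t.kappa c 1 := by
  have hn := h.n_pos'
  have hw := h.w_pos
  have h1 := h.penalty_pos
  have h2 : 0 < t.w c ^ 2 / t.n := by positivity
  unfold kappa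
  positivity

theorem privacyScale_pos : 0 < t.privacyScale c := by
  have hn := h.n_pos'
  have hr := h.r_pos'
  have hw := h.w_pos
  have hL := h.log_pos
  exact lt_max_of_lt_left (by positivity)

theorem w_le : t.w c ≤ Real.sqrt t.n := by
  have hn := h.n_pos'
  refine Real.le_sqrt_of_sq_le ?_
  have := h.w_sq_le
  rwa [div_le_one hn] at this

theorem sqrt_n_div_log_le {x : ℝ} (hx : t.n ≤ x) :
    Real.sqrt t.n / Real.log t.p ≤ Real.sqrt (x / Real.log t.p) := by
  have hL := h.log_pos
  rw [Real.sqrt_div (h.n_pos'.le.trans hx)]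
  exact div_le_div₀ (Real.sqrt_nonneg _) (Real.sqrt_le_sqrt hx) (Real.sqrt_pos.mpr hL)
    h.sqrt_log_le

/-- As `n ≤ r` and `w² ≤ n`, the minimum equals `1`. -/
theorem sqrt_n_div_log_le_mul_min : Real.sqrt t.n / Real.log t.p ≤
    Real.sqrt (t.n / Real.log t.p) * min 1 (min (Real.sqrt (t.r / t.n))
      (Real.sqrt (t.r * t.n) / t.w c ^ 2)) := by
  have hn := h.n_pos'
  have hr := h.r_pos'
  have hnr := h.n_le_r'
  have h1 : (1 : ℝ) ≤ Real.sqrt (t.r / t.n) := by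
    rw [Real.one_le_sqrt, one_le_div hn]; exact hnr
  have h2 : 1 ≤ Real.sqrt (t.r * t.n) / t.w c ^ 2 := by
    have hw := h.w_pos
    rw [one_le_div (by positivity)]
    have h3 : t.w c ^ 2 ≤ t.n := by have := h.w_sq_le; rwa [div_le_one hn] at this
    refine h3.trans (Real.le_sqrt_of_sq_le ?_)
    rw [sq]; exact mul_le_mul_of_nonneg_right hnr hn.le
  rw [min_eq_left (le_min h1 h2), mul_one]
  exact h.sqrt_n_div_log_le le_rfl

/-- The two entries of the minimum are the reciprocals of the two entries of the maximum in
`privacyScale`. -/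
theorem inv_scale_le_min : 1 / t.privacyScale c ≤
    min ((t.n : ℝ) / t.w c ^ 2 * Real.sqrt (t.r / Real.log t.p))
      (Real.sqrt (t.n * t.r) / (t.w c * Real.log t.p)) := by
  have hn := h.n_pos'
  have hr := h.r_pos'
  have hw := h.w_pos
  have hL := h.log_pos
  refine le_min ?_ ?_
  · have h1 : (t.n : ℝ) / t.w c ^ 2 * Real.sqrt (t.r / Real.log t.p) =
        1 / (t.w c ^ 2 / t.n * Real.sqrt (Real.log t.p / t.r)) := by
      rw [← inv_div (Real.log t.p) (t.r : ℝ), Real.sqrt_inv, one_div, mul_inv, inv_div]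
    rw [h1]
    exact one_div_le_one_div_of_le (by positivity) (le_max_right _ _)
  · rw [← one_div_div (t.w c * Real.log t.p)]
    exact one_div_le_one_div_of_le (by positivity) (le_max_left _ _)

theorem scale_le : t.privacyScale c ≤ Real.log t.p / Real.sqrt t.n := by
  have hn := h.n_pos'
  have hr := h.r_pos'
  have hw := h.w_pos
  have hL := h.log_pos
  have hsn := Real.sqrt_le_sqrt h.n_le_r'
  refine max_le ?_ ?_
  · rw [Real.sqrt_mul hn.le, mul_div_mul_comm]
    calc t.w c / Real.sqrt t.n * (Real.log t.p / Real.sqrt t.r)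
        ≤ 1 * (Real.log t.p / Real.sqrt t.n) := by
          refine mul_le_mul ?_ ?_ (by positivity) one_pos.le
          · rw [div_le_one (by positivity)]; exact h.w_le
          · exact div_le_div_of_nonneg_left hL.le (by positivity) hsn
      _ = _ := one_mul _
  · rw [Real.sqrt_div hL.le]
    calc t.w c ^ 2 / t.n * (Real.sqrt (Real.log t.p) / Real.sqrt t.r)
        ≤ 1 * (Real.log t.p / Real.sqrt t.n) :=
          mul_le_mul h.w_sq_le (div_le_div₀ hL.le h.sqrt_log_le (by positivity) hsn)
            (by positivity) one_pos.le
      _ = _ := one_mul _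

theorem sqrt_n_div_log_le_min : Real.sqrt t.n / Real.log t.p ≤
    min (Real.sqrt (t.n / Real.log t.p)) (min (Real.sqrt (t.r / Real.log t.p))
      (min ((t.n : ℝ) / t.w c ^ 2 * Real.sqrt (t.r / Real.log t.p))
      (Real.sqrt (t.n * t.r) / (t.w c * Real.log t.p)))) := by
  refine le_min (h.sqrt_n_div_log_le le_rfl) (le_min (h.sqrt_n_div_log_le h.n_le_r') ?_)
  refine le_trans ?_ h.inv_scale_le_min
  rw [← one_div_div]
  exact one_div_le_one_div_of_le h.privacyScale_pos h.scale_le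

end Admissible

end ParamTuple

/-! ### Exponents of the regime, the four conditions and the debiasing property. -/

/-- Polynomial growth rates under which the private debiased Lasso is asymptotically unbiased. -/
structure PolyRegime (α β γ b : ℝ) (n s₀ r : ℕ → ℕ) (δ σ τ : ℕ → ℝ) : Prop where
  two_lt : 2 < α
  lt_β : α < β
  four_sub_lt : 4 - 2 * γ < β
  β_lt : β < 3 * α / 2 + 2 * γ - 2
  three_sub_lt : 3 - 2 * γ < α
  b_pos : 0 < b
  n_growth : PolyGrowth (fun p => (n p : ℝ)) α
  n_inv_growth : PolyGrowth (fun p => 1 / (n p : ℝ)) (-α)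
  r_growth : PolyGrowth (fun p => (r p : ℝ)) β
  r_inv_growth : PolyGrowth (fun p => 1 / (r p : ℝ)) (-β)
  s₀_growth : PolyGrowth (fun p => (s₀ p : ℝ)) 1
  δ_mem : ∀ p, 0 < δ p ∧ δ p < 1
  δ_growth : PolyGrowth (fun p => Real.log (4 / δ p)) 0
  σ_pos : ∀ p, 0 < σ p
  σ_growth : PolyGrowth σ 0
  σ_inv_growth : PolyGrowth (fun p => 1 / σ p) 0
  τ_growth : PolyGrowth τ 0
  τ_pos : ∀ᶠ p in atTop, 0 < τ p
  n_pos : ∀ᶠ p in atTop, 0 < n p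
  r_pos : ∀ᶠ p in atTop, 0 < r p

namespace PolyRegime

variable {α β γ b : ℝ} {n s₀ r : ℕ → ℕ} {δ σ τ : ℕ → ℝ}

/-- The sequence of parameters. -/
noncomputable abbrev tuple (γ : ℝ) (n s₀ r : ℕ → ℕ) (δ : ℕ → ℝ) (p : ℕ) : ParamTuple :=
  ⟨n p, p, s₀ p, r p, (p : ℝ) ^ γ, δ p⟩

/-- The sequence of model constants. -/
abbrev consts (b : ℝ) (σ τ : ℕ → ℝ) (p : ℕ) : ModelConsts := ⟨b, σ p, τ p⟩

variable (h : PolyRegime α β γ b n s₀ r δ σ τ)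
include h

local notation "t" => tuple γ n s₀ r δ
local notation "c" => consts b σ τ
local notation "ν" => 1 - γ + β / 2 - α

theorem log_four_div_pos (p : ℕ) : 0 < Real.log (4 / δ p) := by
  obtain ⟨h0, h1⟩ := h.δ_mem p
  refine Real.log_pos ?_
  rw [one_lt_div h0]; linarith

theorem w_sq (p : ℕ) : (t p).w (c p) ^ 2 =
    4 * (2 * p * b ^ 2 + (b * Real.sqrt (s₀ p) + τ p) ^ 2) / (p : ℝ) ^ γ *
      (Real.sqrt (2 * r p * Real.log (4 / δ p)) + Real.log (4 / δ p)) := by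
  have hl := h.log_four_div_pos p
  rw [ParamTuple.w, Real.sq_sqrt, ParamTuple.rowBound, Real.sq_sqrt]
  · positivity
  · refine mul_nonneg ?_ (by positivity)
    exact div_nonneg (by positivity) (by positivity)

theorem w_pos {p : ℕ} (hp : 0 < p) : 0 < (t p).w (c p) := by
  have hl := h.log_four_div_pos p
  have hp' : (0 : ℝ) < p := by exact_mod_cast hp
  have hb := h.b_pos
  have hw : 0 < (t p).w (c p) ^ 2 := by
    rw [h.w_sq]
    positivity
  refine lt_of_le_of_ne (Real.sqrt_nonneg _) fun h0 => ?_
  rw [← h0] at hw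
  norm_num at hw

/-- The exponent `ν` collects `1` from `B²`, `-γ` from `1/ε`, `β/2` from `√r` and `-α` from `1/n`;
`τ` and `log(4/δ)` are `p ^ o(1)`. -/
theorem noise_ratio_growth : PolyGrowth (fun p => (t p).w (c p) ^ 2 / n p) ν := by
  have hB : PolyGrowth (fun p : ℕ => 2 * (p : ℝ) * b ^ 2 + (b * Real.sqrt (s₀ p) + τ p) ^ 2) 1 := by
    refine PolyGrowth.add ?_ ?_
    · have := PolyGrowth.natCast.const_mul (2 * b ^ 2)
      exact this.of_abs_le (Eventually.of_forall fun p => by ring_nf; rfl)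
    · have := ((h.s₀_growth.sqrt.const_mul b).add (h.τ_growth.mono (by norm_num))).pow 2
      exact this.mono (by norm_num)
  have hR : PolyGrowth (fun p => Real.sqrt (2 * r p * Real.log (4 / δ p)) +
      Real.log (4 / δ p)) (β / 2) := by
    refine PolyGrowth.add ?_ (h.δ_growth.mono ?_)
    · exact ((h.r_growth.const_mul 2).mul h.δ_growth).sqrt.mono (by linarith)
    · linarith [h.two_lt, h.lt_β]
  have := ((((hB.const_mul 4).mul (PolyGrowth.natCast_rpow (-γ))).mul hR).mul h.n_inv_growth)
  refine (this.of_abs_le (Eventually.of_forall fun p => le_of_eq ?_)).mono (by linarith)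
  rw [h.w_sq, Real.rpow_neg (Nat.cast_nonneg p), ← div_eq_mul_inv, mul_one_div]

theorem nu_lt : ν < -(α / 4) := by linarith [h.β_lt]

theorem admissible : ∀ᶠ p in atTop, (t p).Admissible (c p) := by
  have hlog : Tendsto (fun p : ℕ => Real.log p) atTop atTop :=
    Real.tendsto_log_atTop.comp tendsto_natCast_atTop_atTop
  have hnr := (h.n_growth.mul h.r_inv_growth).eventually_le (by linarith [h.lt_β]) one_pos
  have hv := h.noise_ratio_growth.eventually_le (by linarith [h.nu_lt, h.two_lt]) one_pos
  filter_upwards [hlog.eventually_ge_atTop 1, h.n_pos, h.r_pos, hnr, hv, h.τ_pos,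
    eventually_gt_atTop 0] with p h1 h2 h3 h4 h5 h6 h7
  refine ⟨h1, h2, h3, ?_, h.w_pos h7, h5, h.σ_pos p, h6⟩
  have h3' : (0 : ℝ) < r p := by exact_mod_cast h3
  rw [mul_one_div, div_le_one h3'] at h4
  exact_mod_cast h4

theorem sqrt_n_inv_growth : PolyGrowth (fun p => 1 / Real.sqrt (n p)) (-(α / 2)) := by
  refine (h.n_inv_growth.sqrt.mono (by linarith)).of_abs_le (Eventually.of_forall fun p => ?_)
  rw [one_div, one_div, Real.sqrt_inv]

theorem sqrt_r_inv_growth : PolyGrowth (fun p => 1 / Real.sqrt (r p)) (-(β / 2)) := by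
  refine (h.r_inv_growth.sqrt.mono (by linarith)).of_abs_le (Eventually.of_forall fun p => ?_)
  rw [one_div, one_div, Real.sqrt_inv]

theorem penalty_growth : PolyGrowth (fun p => (t p).penalty (c p) 1) (-(α / 2)) := by
  have h1 : PolyGrowth (fun p => Real.sqrt (Real.log p / n p)) (-(α / 2)) := by
    refine ((PolyGrowth.log.mul h.n_inv_growth).sqrt.mono (by linarith)).of_abs_le
      (Eventually.of_forall fun p => ?_)
    rw [mul_one_div]
  have h2 : PolyGrowth (fun p => Real.sqrt (Real.log p ^ 3 / r p)) (-(α / 2)) := by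
    refine (((PolyGrowth.log.pow 3).mul h.r_inv_growth).sqrt.mono ?_).of_abs_le
      (Eventually.of_forall fun p => ?_)
    · linarith [h.lt_β]
    · rw [mul_one_div]
  exact (((h.σ_growth.const_mul 1)).mul (h1.max h2)).mono (by linarith)

/-- The ratio is `2√s₀ + (w²/n)/λ`, and `λ ≥ σ/√n`. -/
theorem kappa_div_penalty_growth :
    PolyGrowth (fun p => (t p).kappa (c p) 1 / (t p).penalty (c p) 1)
      (max (1 / 2) (ν + α / 2)) := by
  have h1 : PolyGrowth (fun p => 2 * Real.sqrt (s₀ p)) (max (1 / 2) (ν + α / 2)) :=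
    (h.s₀_growth.sqrt.const_mul 2).mono (le_max_left _ _)
  have h2 : PolyGrowth (fun p => (t p).w (c p) ^ 2 / n p * (Real.sqrt (n p) * (1 / σ p)))
      (max (1 / 2) (ν + α / 2)) :=
    (h.noise_ratio_growth.mul (h.n_growth.sqrt.mul h.σ_inv_growth)).mono
      ((le_max_right _ _).trans' (by linarith))
  refine (h1.add h2).of_nonneg_le ?_ ?_
  · filter_upwards [h.admissible] with p hp
    exact (div_pos hp.kappa_pos hp.penalty_pos).le
  · filter_upwards [h.admissible] with p hp
    have hpen := hp.penalty_pos
    have hn : (0 : ℝ) < n p := hp.n_pos'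
    rw [ParamTuple.kappa, add_div]
    refine add_le_add (le_of_eq ?_) ?_
    · rw [mul_right_comm, mul_div_assoc, div_self hpen.ne', mul_one]
    · rw [div_eq_mul_one_div]
      refine mul_le_mul_of_nonneg_left ?_ (by positivity)
      rw [mul_one_div, ← one_div_div (σ p)]
      exact one_div_le_one_div_of_le (div_pos (h.σ_pos p) (Real.sqrt_pos.mpr hn)) hp.le_penalty

theorem w_growth : PolyGrowth (fun p => (t p).w (c p)) ((ν + α) / 2) := by
  refine ((h.noise_ratio_growth.mul h.n_growth).sqrt).of_abs_le ?_
  filter_upwards [h.admissible] with p hp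
  have hn : (0 : ℝ) < n p := hp.n_pos'
  rw [div_mul_cancel₀ _ hn.ne', Real.sqrt_sq hp.w_pos.le]

/-- The factor `√n` stands for `1/ρ`, so decay of this product yields the second and third
conditions. Its two exponents are negative exactly when `β > 4 - 2γ` and `α > 3 - 2γ`. -/
theorem privacyScale_growth : PolyGrowth
    (fun p => Real.sqrt (s₀ p) * Real.sqrt (n p) * (t p).privacyScale (c p))
    (max ((2 - γ - β / 2) / 2) (3 / 2 - γ - α / 2)) := by
  have hsn := h.s₀_growth.sqrt.mul h.n_growth.sqrt
  have h1 := hsn.mul ((h.w_growth.mul PolyGrowth.log).mul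
    (h.sqrt_n_inv_growth.mul h.sqrt_r_inv_growth))
  have h2 := hsn.mul (h.noise_ratio_growth.mul (PolyGrowth.log.mul h.r_inv_growth).sqrt)
  refine ((h1.mono ((le_max_left _ _).trans' (by linarith))).max
    (h2.mono ((le_max_right _ _).trans' (by linarith)))).of_abs_le
    (Eventually.of_forall fun p => le_of_eq ?_)
  congr 1
  rw [ParamTuple.privacyScale, mul_max_of_nonneg _ _ (by positivity), one_div_mul_one_div,
    mul_one_div, mul_one_div, Real.sqrt_mul (Nat.cast_nonneg _)]

theorem scale_exponent_neg : max ((2 - γ - β / 2) / 2) (3 / 2 - γ - α / 2) < 0 :=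
  max_lt (by linarith [h.four_sub_lt]) (by linarith [h.three_sub_lt])

theorem kappa_exponent_lt : max (1 / 2) (ν + α / 2) < α / 4 :=
  max_lt (by linarith [h.two_lt]) (by linarith [h.nu_lt])

theorem log_div_sqrt_n_growth : PolyGrowth (fun p => Real.log p / Real.sqrt (n p)) (-(α / 2)) :=
  ((PolyGrowth.log.mul h.sqrt_n_inv_growth).mono (by linarith)).of_abs_le
    (Eventually.of_forall fun p => by rw [mul_one_div])

theorem sufficientConditions : SufficientConditions 1 t c := by
  have hκ := h.kappa_exponent_lt
  have hk2 := h.kappa_div_penalty_growth.pow 2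
  push_cast at hk2
  have hscale := h.privacyScale_growth.tendsto_zero h.scale_exponent_neg
  have hscaleσ := ((h.σ_inv_growth.mul h.privacyScale_growth).tendsto_zero
    (by linarith [h.scale_exponent_neg]))
  refine ⟨?_, ?_, ?_, ?_⟩
  -- Dropping `phi ≥ 1`, the ratio of the two sides is at most `(κ/λ)² log p / √n`, whose exponent
  -- is negative because that of `κ/λ` is below `α/4`.
  · refine isLittleO_of_eventually_le_mul
      ((hk2.mul h.log_div_sqrt_n_growth).tendsto_zero (by linarith)) ?_ ?_
    · filter_upwards [h.admissible] with p hp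
      have := hp.one_le_phi
      positivity
    · filter_upwards [h.admissible] with p hp
      have hn : (0 : ℝ) < n p := hp.n_pos'
      have hL : 0 < Real.log p := hp.log_pos
      have hpen := hp.penalty_pos
      calc _ ≤ ((t p).kappa (c p) 1 / (t p).penalty (c p) 1) ^ 2 := by
            rw [div_pow]
            exact div_le_div_of_nonneg_left (sq_nonneg _) (by positivity)
              (le_mul_of_one_le_right (sq_nonneg _) hp.one_le_phi)
        _ = ((t p).kappa (c p) 1 / (t p).penalty (c p) 1) ^ 2 *
            (Real.log p / Real.sqrt (n p)) * (Real.sqrt (n p) / Real.log p) := by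
            field_simp
        _ ≤ _ := mul_le_mul_of_nonneg_left hp.sqrt_n_div_log_le_mul_min (by positivity)
  · refine IsBigO.of_bound 1 ?_
    filter_upwards [h.admissible, hscale.eventually_lt_const one_pos] with p hp h1
    have hn : (0 : ℝ) < n p := hp.n_pos'
    have hS := hp.privacyScale_pos
    have hS' : (t p).privacyScale (c p) = max ((t p).w (c p) * Real.log p / Real.sqrt (n p * r p))
      ((t p).w (c p) ^ 2 / n p * Real.sqrt (Real.log p / r p)) := rfl
    simp only [one_mul, Real.norm_eq_abs]
    rw [← hS', abs_of_nonneg (Real.sqrt_nonneg _)]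
    refine le_trans ?_ (le_abs_self _)
    rw [le_div_iff₀ hS]
    refine le_trans ?_ (le_max_left _ _)
    rw [le_div_iff₀ (Real.sqrt_pos.mpr hn)]
    linarith
  · refine isLittleO_of_eventually_le_mul hscaleσ ?_ ?_
    · filter_upwards [h.admissible] with p hp
      have := hp.rho_pos
      have := h.σ_pos p
      positivity
    · filter_upwards [h.admissible] with p hp
      have hn : (0 : ℝ) < n p := hp.n_pos'
      have hS := hp.privacyScale_pos
      have hσ := h.σ_pos p
      calc _ ≤ Real.sqrt (n p) / σ p * Real.sqrt (s₀ p) :=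
            mul_le_mul_of_nonneg_right hp.inv_rho_le (Real.sqrt_nonneg _)
        _ = 1 / σ p * (Real.sqrt (s₀ p) * Real.sqrt (n p) * (t p).privacyScale (c p)) *
            (1 / (t p).privacyScale (c p)) := by
            field_simp
        _ ≤ _ := mul_le_mul_of_nonneg_left hp.inv_scale_le_min (by positivity)
  -- The factor `√n` from `1/ρ` cancels the exponent `-α/2` of the penalty, leaving the same
  -- exponent as in the first condition.
  · have h4 := (((h.n_growth.sqrt.mul h.σ_inv_growth).mul
      ((hk2.mul h.penalty_growth).const_mul 4)).mul h.log_div_sqrt_n_growth)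
    refine isLittleO_of_eventually_le_mul (h4.tendsto_zero (by linarith)) ?_ ?_
    · filter_upwards [h.admissible] with p hp
      have := hp.rho_pos
      have := h.σ_pos p
      have := hp.one_le_phi
      have := hp.penalty_pos
      positivity
    · filter_upwards [h.admissible] with p hp
      have hn : (0 : ℝ) < n p := hp.n_pos'
      have hL : 0 < Real.log p := hp.log_pos
      have hσ := h.σ_pos p
      have hpen := hp.penalty_pos
      have hphi := hp.one_le_phi
      have h5 : 4 * (t p).kappa (c p) 1 ^ 2 / ((t p).penalty (c p) 1 * (t p).phi (c p)) ≤
          4 * (((t p).kappa (c p) 1 / (t p).penalty (c p) 1) ^ 2 * (t p).penalty (c p) 1) := by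
        calc _ ≤ 4 * (t p).kappa (c p) 1 ^ 2 / (t p).penalty (c p) 1 :=
              div_le_div_of_nonneg_left (by positivity) hpen (le_mul_of_one_le_right hpen.le hphi)
          _ = _ := by field_simp
      calc _ ≤ Real.sqrt (n p) / σ p *
            (4 * (((t p).kappa (c p) 1 / (t p).penalty (c p) 1) ^ 2 * (t p).penalty (c p) 1)) :=
            mul_le_mul hp.inv_rho_le h5 (by positivity) (by positivity)
        _ = Real.sqrt (n p) * (1 / σ p) *
            (4 * (((t p).kappa (c p) 1 / (t p).penalty (c p) 1) ^ 2 * (t p).penalty (c p) 1)) *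
            (Real.log p / Real.sqrt (n p)) * (Real.sqrt (n p) / Real.log p) := by
            field_simp
        _ ≤ _ := mul_le_mul_of_nonneg_left hp.sqrt_n_div_log_le_min (by positivity)

theorem log_div_sqrt_r_growth : PolyGrowth (fun p => Real.log p / Real.sqrt (r p)) (-(β / 2)) :=
  ((PolyGrowth.log.mul h.sqrt_r_inv_growth).mono (by linarith)).of_abs_le
    (Eventually.of_forall fun p => by rw [mul_one_div])

theorem l1_bound_growth : PolyGrowth (fun p => 4 * (p * ((t p).penalty (c p) 1 +
      (Real.log p * τ p / Real.sqrt (n p) +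
      Real.log p / Real.sqrt (r p) * (Real.sqrt (b ^ 2 + 1) *
        Real.sqrt (τ p ^ 2 + 2 * ((t p).w (c p) ^ 2 / n p))))) +
      Real.sqrt p * ((t p).w (c p) ^ 2 / n p))) (max (1 - α / 2) (1 / 2 + ν)) := by
  have hν : ν < 0 := by linarith [h.nu_lt, h.two_lt]
  have h1 : PolyGrowth (fun p => Real.log p * τ p / Real.sqrt (n p)) (-(α / 2)) :=
    (((PolyGrowth.log.mul h.τ_growth).mul h.sqrt_n_inv_growth).mono (by linarith)).of_abs_le
      (Eventually.of_forall fun p => by rw [mul_one_div])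
  have h2 : PolyGrowth (fun p => Real.sqrt (τ p ^ 2 + 2 * ((t p).w (c p) ^ 2 / n p))) 0 :=
    (((h.τ_growth.pow 2).mono (by norm_num)).add
      ((h.noise_ratio_growth.const_mul 2).mono hν.le)).sqrt.mono (by norm_num)
  have h3 := (h.log_div_sqrt_r_growth.mul (h2.const_mul (Real.sqrt (b ^ 2 + 1)))).mono
    (by linarith [h.lt_β] : -(β / 2) + 0 ≤ -(α / 2))
  have h4 := PolyGrowth.natCast.mul (h.penalty_growth.add (h1.add h3))
  have h5 := PolyGrowth.natCast.sqrt.mul h.noise_ratio_growth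
  exact ((h4.mono ((le_max_left _ _).trans' (by linarith))).add
    (h5.mono (le_max_right _ _))).const_mul 4

/-- Multiplication by `√n` absorbs the coefficient size `p ^ (-α/2)`, so the exponents of the ℓ¹
bound survive; `(α - β + ν)/2` comes from the term in `[0; -θ₀; 1]`. -/
theorem bias_bound_growth : PolyGrowth (fun p => Real.sqrt (n p) * (1 / σ p) *
      ((Real.log p / Real.sqrt (n p) + Real.log p / Real.sqrt (r p) * (b ^ 2 + 1)) *
      (4 * (p * ((t p).penalty (c p) 1 +
      (Real.log p * τ p / Real.sqrt (n p) +
      Real.log p / Real.sqrt (r p) * (Real.sqrt (b ^ 2 + 1) *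
        Real.sqrt (τ p ^ 2 + 2 * ((t p).w (c p) ^ 2 / n p))))) +
      Real.sqrt p * ((t p).w (c p) ^ 2 / n p))) +
      Real.log p / Real.sqrt (r p) * (Real.sqrt (b ^ 2 + 1) *
        Real.sqrt (2 * ((t p).w (c p) ^ 2 / n p)))))
    (max (max (1 - α / 2) (1 / 2 + ν)) ((α - β + ν) / 2)) := by
  have h1 := h.log_div_sqrt_n_growth.add ((h.log_div_sqrt_r_growth.mul
    (PolyGrowth.const (b ^ 2 + 1))).mono (by linarith [h.lt_β] : -(β / 2) + 0 ≤ -(α / 2)))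
  have h2 := h.log_div_sqrt_r_growth.mul
    ((h.noise_ratio_growth.const_mul 2).sqrt.const_mul (Real.sqrt (b ^ 2 + 1)))
  have h3 := h1.mul h.l1_bound_growth
  have h4 := (h.n_growth.sqrt.mul h.σ_inv_growth).mul
    ((h3.mono (a' := max (max (1 - α / 2) (1 / 2 + ν)) ((α - β + ν) / 2) - α / 2) ?_).add
    (h2.mono ?_))
  · exact h4.mono (by linarith)
  · linarith [le_max_left (max (1 - α / 2) (1 / 2 + ν)) ((α - β + ν) / 2)]
  · linarith [le_max_right (max (1 - α / 2) (1 / 2 + ν)) ((α - β + ν) / 2)]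

theorem eventually_bias_le {θ₀ : (p : ℕ) → Fin p → ℝ} (hθ : ∀ᶠ p in atTop, ∑ j, θ₀ p j ^ 2 = 1)
    {η : ℝ} (hη : 0 < η) : ∀ᶠ p in atTop, ∀ (ω : (t p).Sample) (θ : Fin p → ℝ),
      ω.Regular (c p) (θ₀ p) (Real.log p) → ω.IsLasso (c p) (θ₀ p) 1 θ →
      ‖ω.bias (c p) (θ₀ p) θ‖ / (σ p * (t p).rho (c p)) ≤ η := by
  have hα := h.two_lt
  have hβ := h.lt_β
  have hν := h.nu_lt
  have h1 := h.bias_bound_growth.eventually_le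
    (max_lt (max_lt (by linarith) (by linarith)) (by linarith)) hη
  have hpe := (PolyGrowth.natCast.mul (h.log_div_sqrt_n_growth.add
    ((h.log_div_sqrt_r_growth.mul (PolyGrowth.const (b ^ 2 + 1))).mono
      (by linarith : -(β / 2) + 0 ≤ -(α / 2))))).eventually_le (by linarith)
      (η := 1 / 2) (by norm_num)
  filter_upwards [h1, hpe, h.admissible, hθ] with p h1 hpe hp hθ ω θ hω hlasso
  have hn : (0 : ℝ) < n p := hp.n_pos'
  have hL : 0 < Real.log p := hp.log_pos
  have hσ := h.σ_pos p
  have hl1 := hω.l1_error_le (c p) hlasso hp.penalty_pos.le hθ hp.n_pos hL.le hp.τ_pos.le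
    hp.w_sq_le hpe
  have hbias := hω.norm_bias_le (c p) (θ := θ) hθ hp.n_pos hL.le hp.w_sq_le
  have hrho : 1 / (σ p * (t p).rho (c p)) ≤ Real.sqrt (n p) * (1 / σ p) := by
    rw [mul_one_div]; exact hp.inv_rho_le
  have hrho0 := hp.rho_pos
  rw [div_eq_mul_one_div, mul_comm]
  refine le_trans (mul_le_mul hrho (hbias.trans (add_le_add
    (mul_le_mul_of_nonneg_left hl1 ?_) le_rfl)) (norm_nonneg _) (by positivity)) h1
  positivity

theorem debiasingProperty {D : Measure ℝ} (hD : IsDesignLaw D b) {θ₀ : (p : ℕ) → Fin p → ℝ}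
    (hθ : ∀ᶠ p in atTop, ∑ j, θ₀ p j ^ 2 = 1) : DebiasingProperty 1 t c D θ₀ := by
  intro η hη
  have hb := h.b_pos
  have hlim : Tendsto (fun p : ℕ => (p : ENNReal) ^ 2 *
        ENNReal.ofReal (2 * Real.exp (-Real.log p ^ 2 / (2 * (b ^ 2 + 1) ^ 2))) +
      (p : ENNReal) * ENNReal.ofReal (2 * Real.exp (-Real.log p ^ 2 / (2 * b ^ 2))) +
      ((p : ENNReal) ^ 2 + 2 * p) * ENNReal.ofReal (4 * Real.exp (-Real.log p ^ 2 / 16)))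
      atTop (𝓝 0) := by
    have h1 := tendsto_natCast_pow_mul_exp_neg_log_sq 2 2
      (by positivity : 0 < 2 * (b ^ 2 + 1) ^ 2)
    have h2 := tendsto_natCast_pow_mul_exp_neg_log_sq 1 2 (by positivity : 0 < 2 * b ^ 2)
    have h3 := tendsto_natCast_pow_mul_exp_neg_log_sq 2 4 (by norm_num : (0 : ℝ) < 16)
    have h4 := tendsto_natCast_pow_mul_exp_neg_log_sq 1 4 (by norm_num : (0 : ℝ) < 16)
    have h5 := (h1.add h2).add (h3.add (h4.add h4))
    simp only [add_zero, pow_one] at h5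
    refine h5.congr fun p => ?_
    ring
  have hLr := h.log_div_sqrt_r_growth.eventually_le (by linarith [h.two_lt, h.lt_β]) one_pos
  refine tendsto_of_tendsto_of_tendsto_of_le_of_le' tendsto_const_nhds hlim
    (Eventually.of_forall fun _ => zero_le) ?_
  filter_upwards [h.admissible, h.eventually_bias_le hθ hη, hLr] with p hp hbias hLr
  have hr : (0 : ℝ) < r p := hp.r_pos'
  rw [div_le_one (Real.sqrt_pos.mpr hr)] at hLr
  -- Monotonicity of the outer measure suffices, so the event quantified over all minimizers need
  -- not be measurable.
  refine le_trans (measure_mono fun ω hω => ?_) (ParamTuple.sampleLaw_not_regular_le (c p) hD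
    hp.σ_pos hp.τ_pos hp.n_pos hp.r_pos hp.log_pos hLr (θ₀ p))
  obtain ⟨θ, hθ, hlt⟩ := hω
  exact fun hreg => absurd (hbias ω θ hreg hθ) (not_le.mpr hlt)

end PolyRegime

/-- Once `p ^ a ≥ 2`, rounding changes it by at most a factor `2` either way. -/
theorem PolyGrowth.of_abs_sub_rpow_le {f : ℕ → ℝ} {a : ℝ} (ha : 0 < a)
    (hf : ∀ p : ℕ, |f p - (p : ℝ) ^ a| ≤ 1) :
    PolyGrowth f a ∧ PolyGrowth (fun p => 1 / f p) (-a) ∧ Tendsto f atTop atTop := by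
  have hp : Tendsto (fun p : ℕ => (p : ℝ) ^ a) atTop atTop :=
    (tendsto_rpow_atTop ha).comp tendsto_natCast_atTop_atTop
  have h1 := hp.eventually_ge_atTop 2
  refine ⟨((PolyGrowth.natCast_rpow a).const_mul 2).of_nonneg_le ?_ ?_,
    ((PolyGrowth.natCast_rpow (-a)).const_mul 2).of_nonneg_le ?_ ?_, ?_⟩
  · filter_upwards [h1] with p h2
    linarith [(abs_le.mp (hf p)).1]
  · filter_upwards [h1] with p h2
    linarith [(abs_le.mp (hf p)).2]
  · filter_upwards [h1] with p h2
    exact div_nonneg one_pos.le (by linarith [(abs_le.mp (hf p)).1])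
  · filter_upwards [h1] with p h2
    have h3 := (abs_le.mp (hf p)).1
    rw [Real.rpow_neg (Nat.cast_nonneg p), ← div_eq_mul_inv,
      div_le_div_iff₀ (by linarith) (by linarith)]
    linarith
  · refine tendsto_atTop_mono (fun p => ?_) (tendsto_atTop_add_const_right _ (-1) hp)
    linarith [(abs_le.mp (hf p)).1]

theorem PolyGrowth.log_of_tendsto {f : ℕ → ℝ} {a : ℝ} (hf : PolyGrowth f a)
    (hf' : Tendsto f atTop atTop) : PolyGrowth (fun p => Real.log (f p)) 0 := by
  obtain ⟨k, hk0, hk⟩ := (hf (a + 1) (by linarith)).exists_pos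
  refine ((PolyGrowth.const (Real.log k)).add (PolyGrowth.log.const_mul (a + 1))).of_nonneg_le ?_ ?_
  · filter_upwards [hf'.eventually_ge_atTop 1] with p h1
    exact Real.log_nonneg h1
  · filter_upwards [hf'.eventually_ge_atTop 1, hk.bound, eventually_gt_atTop 0] with p h1 h2 h3
    have hp : (0 : ℝ) < p := by exact_mod_cast h3
    rw [Real.norm_of_nonneg (by linarith), Real.norm_of_nonneg (by positivity)] at h2
    refine (Real.log_le_log (by linarith) h2).trans_eq ?_
    rw [Real.log_mul hk0.ne' (by positivity), Real.log_rpow hp]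

theorem mainTheorem7 :
    ∃ C : ℝ, 0 < C ∧
      ∀ (α γ c₀ : ℝ) (n s₀ : ℕ → ℕ) (δ : ℕ → ℝ),
        2 < α → 3 / 4 < γ → 0 < c₀ → c₀ < 1 →
        (∀ p : ℕ, |(n p : ℝ) - (p : ℝ) ^ α| ≤ 1) →
        (∀ p : ℕ, |(s₀ p : ℝ) - c₀ * p| ≤ 1) →
        (∀ p : ℕ, 0 < δ p ∧ δ p < 1) →
        ((fun p : ℕ => Real.log (1 / δ p)) =O[atTop] fun p : ℕ => Real.log p) →
        ∃ r : ℕ → ℕ, Tendsto r atTop atTop ∧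
          ∀ (D : Measure ℝ) (b : ℝ) (σ τ : ℕ → ℝ) (θ₀ : (p : ℕ) → Fin p → ℝ),
            IsDesignLaw D b →
            (∀ p, 0 < σ p) → (σ =Θ[atTop] fun _ : ℕ => (1 : ℝ)) →
            (τ =O[atTop] fun p : ℕ => σ p * Real.sqrt (Real.log (n p))) →
            Tendsto (fun p : ℕ => τ p / σ p - Real.sqrt (2 * Real.log (2 * n p))) atTop atTop →
            (∀ᶠ p in atTop, ∑ j, θ₀ p j ^ 2 = 1 ∧ (Function.support (θ₀ p)).ncard = s₀ p) →
            SufficientConditions C (fun p => ⟨n p, p, s₀ p, r p, (p : ℝ) ^ γ, δ p⟩)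
                (fun p => ⟨b, σ p, τ p⟩) ∧
              DebiasingProperty C (fun p => ⟨n p, p, s₀ p, r p, (p : ℝ) ^ γ, δ p⟩)
                (fun p => ⟨b, σ p, τ p⟩) D θ₀ := by
  refine ⟨1, one_pos, fun α γ c₀ n s₀ δ hα hγ hc₀ hc₁ hn hs hδ hδlog => ?_⟩
  -- The inequality `4 - 2γ < 3α/2 + 2γ - 2` reads `6 < 3α/2 + 4γ`, with equality at the corner `α =
  -- 2`, `γ = 3/4`. The choice of `β` involves only `α` and `γ`, so `r` does not depend on the
  -- model.
  obtain ⟨β, hβ1, hβ2⟩ : ∃ β, max α (4 - 2 * γ) < β ∧ β < 3 * α / 2 + 2 * γ - 2 :=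
    exists_between (max_lt (by linarith) (by linarith))
  rw [max_lt_iff] at hβ1
  have hβ0 : 0 < β := by linarith
  have hr : ∀ p : ℕ, |((⌈(p : ℝ) ^ β⌉₊ : ℕ) : ℝ) - (p : ℝ) ^ β| ≤ 1 := by
    intro p
    have h0 : (0 : ℝ) ≤ (p : ℝ) ^ β := by positivity
    rw [abs_le]
    constructor <;> linarith [Nat.le_ceil ((p : ℝ) ^ β), Nat.ceil_lt_add_one h0]
  obtain ⟨hr1, hr2, hr3⟩ := PolyGrowth.of_abs_sub_rpow_le hβ0 hr
  obtain ⟨hn1, hn2, hn3⟩ := PolyGrowth.of_abs_sub_rpow_le (by linarith : 0 < α) hn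
  rw [tendsto_natCast_atTop_iff] at hr3
  refine ⟨fun p => ⌈(p : ℝ) ^ β⌉₊, hr3, fun D b σ τ θ₀ hD hσ hσΘ hτ hτσ hθ => ?_⟩
  have hσ1 : PolyGrowth σ 0 := PolyGrowth.of_isBigO hσΘ.1 (PolyGrowth.const 1)
  have h : PolyRegime α β γ b n s₀ (fun p => ⌈(p : ℝ) ^ β⌉₊) δ σ τ :=
    { two_lt := hα
      lt_β := hβ1.1
      four_sub_lt := hβ1.2
      β_lt := hβ2
      three_sub_lt := by linarith
      b_pos := hD.pos
      n_growth := hn1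
      n_inv_growth := hn2
      r_growth := hr1
      r_inv_growth := hr2
      s₀_growth := by
        refine ((PolyGrowth.natCast.const_mul c₀).add
          ((PolyGrowth.const 1).mono one_pos.le)).of_nonneg_le
          (Eventually.of_forall fun p => Nat.cast_nonneg _) (Eventually.of_forall fun p => ?_)
        linarith [(abs_le.mp (hs p)).2]
      δ_mem := hδ
      δ_growth := by
        refine ((PolyGrowth.const (Real.log 4)).add
          (PolyGrowth.of_isBigO hδlog PolyGrowth.log)).of_abs_le
          (Eventually.of_forall fun p => le_of_eq ?_)
        rw [← Real.log_mul (by norm_num) (one_div_pos.mpr (hδ p).1).ne', mul_one_div]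
      σ_pos := hσ
      σ_growth := hσ1
      σ_inv_growth := by
        have h1 := hσΘ.inv.1
        exact PolyGrowth.of_isBigO (by simpa using h1) (PolyGrowth.const 1)
      τ_growth := by
        refine PolyGrowth.of_isBigO hτ ((hσ1.mul (hn1.log_of_tendsto hn3).sqrt).mono (by norm_num))
      τ_pos := by
        filter_upwards [hτσ.eventually_gt_atTop 0] with p hp
        have h1 := Real.sqrt_nonneg (2 * Real.log (2 * n p))
        have h2 : 0 < τ p / σ p := by linarith
        exact (div_pos_iff_of_pos_right (hσ p)).mp h2
      n_pos := (tendsto_natCast_atTop_iff.mp hn3).eventually_gt_atTop 0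
      r_pos := hr3.eventually_gt_atTop 0 }
  exact ⟨h.sufficientConditions, h.debiasingProperty hD (hθ.mono fun _ h => h.1)⟩
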